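/- All graphs are finite and simple. A graph $H$ is a minor of a graph $G$ (written $H\le G$) if there are pairwise disjoint non-empty connected vertex sets $B_v\subseteq V(G)$, $v\in V(H)$, such that for every edge $vw$ of $H$ some edge of $G$ joins $B_v$ and $B_w$. For a partition $\mathcal P$ of a subset $S\subseteq V(G)$ into non-empty parts, $G/\!\!/\mathcal P$ is the simple graph obtained from $G$ by identifying each part of $\mathcal P$ into a single vertex, and $|S|$ is the order of $\mathcal P$. Let $\mathsf{idf}(G)$ be the minimum order of such a $\mathcal P$ for which $G/\!\!/\mathcal P$ is a forest, and let $\mathcal F^{(k)}=\{G\mid \mathsf{idf}(G)\le k\}$. For a graph class $\mathcal C$, $\mathsf{obs}(\mathcal C)$ is the set of graphs $G\notin\mathcal C$ such that every minor of $G$ not isomorphic to $G$ belongs to $\mathcal C$. A parametric graph is a sequence $\mathscr G=\langle\mathscr G_k\rangle_{k\in\mathbb N}$ of graphs with $\mathscr G_k\le\mathscr G_{k+1}$ for all $k$. Two of them are comparable if every graph of one of them is a minor of some graph of the other. For a minor-monotone graph parameter $\mathsf p$ (that is, $\mathsf p(H)\le\mathsf p(G)$ whenever $H\le G$), a finite set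 $\mathfrak G$ of pairwise non-comparable parametric graphs is a universal obstruction of $\mathsf p$ with gap function $f:\mathbb N\to\mathbb N$ if, for every $k\in\mathbb N$, (i) every graph $G$ with $\mathscr G_k\not\le G$ for all $\mathscr G\in\mathfrak G$ satisfies $\mathsf p(G)\le f(k)$, and (ii) $f(\mathsf p(\mathscr G_k))\ge k$ for all $\mathscr G\in\mathfrak G$. Let $k\cdot K_3$ be the disjoint union of $k$ triangles, let $C_k$ be the cycle on $k$ vertices (for $k\le 2$, $C_k:=K_k$), and let $k*K_3$ (the $k$-marguerite) be the graph obtained from $k\cdot K_3$ by selecting one vertex of each triangle and identifying the selected vertices into a single one (with $0*K_3:=K_1$). Theorem. The parameter $\mathsf{idf}$ is minor-monotone, and $\{\langle k\cdot K_3\rangle_{k\in\mathbb N},\langle C_k\rangle_{k\in\mathbb N},\langle k*K_3\rangle_{k\in\mathbb N}\}$ is a universal obstruction of $\mathsf{idf}$ with some gap function $f(k)=\mathcal O(k^4\log^2 k)$. In particular, every graph that excludes $C_k$, $k\cdot K_3$ and $k*K_3$ as minors has $\mathsf{idf}(G)\le f(k)=\mathcal O(k^4\log^2 k)$. Moreover: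 - $C_{2k+1}\in\mathsf{obs}(\mathcal F^{(k)})$ for every $k\ge1$; - $\lfloor k/2+1\rfloor\cdot K_3\in\mathsf{obs}(\mathcal F^{(k)})$ for every $k\ge0$; - $k*K_3\in\mathsf{obs}(\mathcal F^{(k)})$ for every $k\ge1$, $1*K_3\in\mathsf{obs}(\mathcal F^{(0)})$, and $(k+1)*K_3\notin\mathcal F^{(k)}$ for every $k\ge0$. -/

import Mathlib

namespace IdForest

/-- A finite simple graph, bundled with its vertex set. -/
structure FinGraph where
  V : Type
  [fin : Finite V]
  graph : SimpleGraph V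

attribute [instance] FinGraph.fin

/-- A graph parameter. -/
abbrev GraphParam := FinGraph → ℕ

/-! ### Minors -/

/-- `H` is a minor of `G`: there is a model of `H` in `G`, i.e. pairwise disjoint connected
(in particular nonempty) branch sets `B v ⊆ V(G)`, for `v ∈ V(H)`, such that the branch sets of
adjacent vertices of `H` are joined by an edge of `G`. -/
def IsMinor (H G : FinGraph) : Prop :=
  ∃ B : H.V → Set G.V,
    (∀ v, (G.graph.induce (B v)).Connected) ∧
    (∀ v w, v ≠ w → Disjoint (B v) (B w)) ∧
    (∀ v w, H.graph.Adj v w → ∃ x ∈ B v, ∃ y ∈ B w, G.graph.Adj x y)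

/-- `G` is a minor-minimal graph outside the class `C`: `G ∉ C`, and every minor of `G` that is
not in `C` is `G` itself, up to isomorphism. -/
def IsObstruction (C : Set FinGraph) (G : FinGraph) : Prop :=
  G ∉ C ∧ ∀ H : FinGraph, IsMinor H G → H ∉ C → Nonempty (H.graph ≃g G.graph)

/-! ### Identifications -/

/-- Given a family of vertex sets ("bags") `B` of `G`, the graph with one vertex for each bag,
two distinct ones being adjacent when some edge of `G` joins the two bags. -/
def bagGraph {V W : Type} (G : SimpleGraph V) (B : W → Set V) : SimpleGraph W where
  Adj a b := a ≠ b ∧ ∃ x ∈ B a, ∃ y ∈ B b, G.Adj x y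
  symm := ⟨by
    rintro a b ⟨hab, x, hx, y, hy, h⟩
    exact ⟨hab.symm, y, hy, x, hx, h.symm⟩⟩
  loopless := ⟨fun _ h => h.1 rfl⟩

/-- The identification of a vertex set `X` of `G`: delete `X` and add one new vertex (the heir
of `X`, here `Sum.inr ()`) adjacent to all the vertices outside `X` that have a neighbour in
`X`. -/
abbrev identify (G : FinGraph) (X : Set G.V) : FinGraph where
  V := {v : G.V // v ∉ X} ⊕ Unit
  graph := bagGraph G.graph (Sum.elim (fun v => {v.1}) (fun _ => X))

/-- `P` is a partition of a subset of `V`, namely of `⋃₀ P`: its members are nonempty and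
pairwise disjoint. -/
def IsPartialPartition {V : Type} (P : Set (Set V)) : Prop :=
  ∅ ∉ P ∧ P.PairwiseDisjoint id

/-- The identification of a partition `P` of a subset of the vertices of `G`: every member of `P`
is identified to a single vertex (its heir). The vertices are the vertices of `G` outside `⋃₀ P`
and the members of `P`. -/
abbrev identifyPartition (G : FinGraph) (P : Set (Set G.V)) : FinGraph where
  V := {v : G.V // v ∉ ⋃₀ P} ⊕ P
  graph := bagGraph G.graph (Sum.elim (fun v => {v.1}) (fun S => S.1))

/-- `G` admits an identification to the class `C` of order exactly `m`: some partition `P` of some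
set of `m` vertices of `G` is such that identifying the members of `P` yields a graph of `C`. -/
def AdmitsIdentification (C : Set FinGraph) (G : FinGraph) (m : ℕ) : Prop :=
  ∃ P : Set (Set G.V), IsPartialPartition P ∧ (⋃₀ P).ncard = m ∧ identifyPartition G P ∈ C

/-- The class of forests. -/
def forests : Set FinGraph := {G | G.graph.IsAcyclic}

/-- The minimum order of an identification of `G` to a forest. -/
noncomputable def idf : GraphParam := fun G => sInf {m | AdmitsIdentification forests G m}

/-- The class of graphs that admit an identification to a forest of order at most `k`. -/
def forestsId (k : ℕ) : Set FinGraph := {G | idf G ≤ k}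

/-- Every graph admits an identification to a forest, so that the minimum defining `idf` is
attained. -/
theorem admits_idf (G : FinGraph) : AdmitsIdentification forests G (idf G) := by
  refine Nat.sInf_mem (s := {m | AdmitsIdentification forests G m}) ?_
  refine ⟨_, {S | S = Set.univ ∧ S.Nonempty}, ⟨?_, ?_⟩, rfl, ?_⟩
  · rintro ⟨_, h⟩
    simp at h
  · rintro A ⟨rfl, -⟩ B ⟨rfl, -⟩ h
    exact absurd rfl h
  · have hsub : Subsingleton (identifyPartition G {S | S = Set.univ ∧ S.Nonempty}).V := by
      refine ⟨?_⟩
      have key : ∀ v : G.V, v ∈ ⋃₀ {S : Set G.V | S = Set.univ ∧ S.Nonempty} :=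
        fun v => ⟨Set.univ, ⟨rfl, ⟨v, trivial⟩⟩, trivial⟩
      rintro (⟨v, hv⟩ | ⟨A, hA, -⟩) (⟨w, hw⟩ | ⟨B, hB, -⟩)
      · exact absurd (key v) hv
      · exact absurd (key v) hv
      · exact absurd (key w) hw
      · subst hA hB
        rfl
    change (identifyPartition G _).graph.IsAcyclic
    rw [Subsingleton.elim (identifyPartition G _).graph ⊥]
    exact SimpleGraph.isAcyclic_bot

/-! ### Parametric graphs and universal obstructions -/

/-- A parametric graph is a sequence of graphs that is monotone for the minor relation. -/
def IsParametric (A : ℕ → FinGraph) : Prop := ∀ k, IsMinor (A k) (A (k + 1))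

/-- Two parametric graphs are comparable if every graph of one of them is a minor of some graph
of the other. -/
def Comparable (A B : ℕ → FinGraph) : Prop :=
  (∀ k, ∃ m, IsMinor (A k) (B m)) ∨ (∀ k, ∃ m, IsMinor (B k) (A m))

/-- A graph parameter that does not increase when taking minors. -/
def MinorMonotone (p : GraphParam) : Prop := ∀ H G : FinGraph, IsMinor H G → p H ≤ p G

/-- `𝔊` is a universal obstruction of the parameter `p`, with gap function `f`. -/
structure IsUniversalObstruction (𝔊 : Set (ℕ → FinGraph)) (p : GraphParam) (f : ℕ → ℕ) :
    Prop where
  finite : 𝔊.Finite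
  minorMonotone : MinorMonotone p
  parametric : ∀ A ∈ 𝔊, IsParametric A
  noncomparable : 𝔊.Pairwise fun A B => ¬ Comparable A B
  upper : ∀ (k : ℕ) (G : FinGraph), (∀ A ∈ 𝔊, ¬ IsMinor (A k) G) → p G ≤ f k
  lower : ∀ A ∈ 𝔊, ∀ k : ℕ, k ≤ f (p (A k))

/-! ### The three parametric graphs -/

/-- `C_k`, the cycle on `k` vertices for `3 ≤ k` (and the complete graph on `k` vertices for
`k ≤ 2`). -/
abbrev cycles (k : ℕ) : FinGraph where
  V := Fin k
  graph := SimpleGraph.cycleGraph k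

/-- `k·K₃`, the disjoint union of `k` triangles; the vertices of the `i`-th triangle are
`(i, 0)`, `(i, 1)` and `(i, 2)`. -/
abbrev triangles (k : ℕ) : FinGraph where
  V := Fin k × Fin 3
  graph :=
    { Adj := fun u v => u.1 = v.1 ∧ u.2 ≠ v.2
      symm := ⟨fun _ _ h => ⟨h.1.symm, h.2.symm⟩⟩
      loopless := ⟨fun _ h => h.2 rfl⟩ }

/-- `k*K₃`, the `k`-marguerite, obtained from `k·K₃` by identifying a set that contains exactly
one vertex of each triangle. -/
def marguerite (k : ℕ) : FinGraph :=
  identify (triangles k) {v : Fin k × Fin 3 | v.2 = 0}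

end IdForest

/-!
An identification of `G` to a forest is the same as a map from `G` to a forest `F` that sends
adjacent vertices to equal or adjacent vertices; its order is the number of vertices at which the
map is not injective (`idf_le_iff`). Contracting images of branch sets in `F` gives minor
monotonicity (`minorMonotone_idf`). Two facts then control `idf`. Identifying a vertex cover leaves
a star, so `idf` is at most the vertex cover number (`idfOn_of_cover`); and an edge that is not a
bridge has an end at which the map is not injective, so `idf` is at least the vertex cover number of
the edges that are not bridges (`exists_cover_of_idf`). This gives the lower bounds for the three
families. For minimality, a minor not isomorphic to `G` makes no use of some edge `e` of `G`
(`IsMinor.exists_unused_edge`), and a small vertex cover of the other edges of `G` gives one of the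
minor. For `k·K₃` and `k*K₃` a pendant or isolated piece with at most two edges may stay uncovered,
and is added by `idfOn_union`.

The upper bound needs no Erdős–Pósa theorem. Let `G` have no `C_k`, `k·K₃` or `k*K₃` minor.

* If `G` is nonseparable, the vertices of a depth-first search tree that are not leaves form a
  vertex cover (`Nonsep.idfOn`). For each `j ≥ 1` there are fewer than `k` vertices of height `j`:
  their subtrees are petals around the connected set of the vertices of larger height. Back edges
  span fewer than `k` levels, since there is no `C_k`, so each vertex of height more than `k` has a
  triangle model in its subtree within the next `2k` levels. Such models are disjoint for vertices
  whose depths are congruent modulo `2k`, so there are fewer than `k` of these vertices in each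
  residue class. Hence the cover has at most `3k²` vertices.
* In general, `idf` is subadditive when graphs are glued at one vertex (`idfOn_union`), so that it
  is at most `3k²` times the number of nonseparable blocks (`exists_blocks`). There are at most
  `2k²` blocks (`card_blocks_le`): many blocks through a vertex give a marguerite, and many blocks
  attached at distinct vertices give many disjoint ones.

So `idf G ≤ 6k⁴`, and the gap function `6(k + 3)⁴` even avoids the logarithmic factor.
-/

namespace IdForest

/-! ### Reachability and connected vertex sets -/

theorem reachable_of_map {V W : Type*} {G : SimpleGraph V} {H : SimpleGraph W} (f : V → W)
    (h : ∀ x y, G.Adj x y → H.Reachable (f x) (f y)) {u v : V} (huv : G.Reachable u v) :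
    H.Reachable (f u) (f v) := by
  rw [SimpleGraph.reachable_iff_reflTransGen] at huv
  induction huv with
  | refl => exact .rfl
  | tail _ hbc ih => exact ih.trans (h _ _ hbc)

/-- A vertex set is connected if and only if it is nonempty and every proper nonempty subset is
left by an edge. -/
theorem connected_induce_iff_cut {V : Type*} {G : SimpleGraph V} {S : Set V} :
    (G.induce S).Connected ↔ S.Nonempty ∧ ∀ T ⊆ S, T.Nonempty → (S \ T).Nonempty →
      ∃ x ∈ T, ∃ y ∈ S \ T, G.Adj x y := by
  constructor
  · intro h
    refine ⟨Set.nonempty_coe_sort.1 h.nonempty, ?_⟩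
    rintro T hTS ⟨x, hx⟩ ⟨y, hyS, hyT⟩
    by_contra! hno
    have key : ∀ b : S, Relation.ReflTransGen (G.induce S).Adj ⟨x, hTS hx⟩ b → b.1 ∈ T := by
      intro b hb
      induction hb with
      | refl => exact hx
      | @tail b c _ hbc ih =>
        by_contra hc
        exact hno _ ih _ ⟨c.2, hc⟩ hbc
    exact hyT (key ⟨y, hyS⟩ ((SimpleGraph.reachable_iff_reflTransGen _ _).1 (h.preconnected _ _)))
  · rintro ⟨⟨u, hu⟩, h⟩
    rw [SimpleGraph.connected_iff_exists_forall_reachable]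
    refine ⟨⟨u, hu⟩, ?_⟩
    by_contra! hno
    obtain ⟨w, hw⟩ := hno
    obtain ⟨x, ⟨hxS, hx⟩, y, ⟨hyS, hy⟩, hxy⟩ := h
      {v | ∃ hv : v ∈ S, (G.induce S).Reachable ⟨u, hu⟩ ⟨v, hv⟩} (fun v hv => hv.1)
      ⟨u, hu, .rfl⟩ ⟨w.1, w.2, fun hw' => hw hw'.2⟩
    exact hy ⟨hyS, hx.trans (SimpleGraph.Adj.reachable (G := G.induce S)
      (u := ⟨x, hxS⟩) (v := ⟨y, hyS⟩) hxy)⟩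

theorem connected_induce_singleton {V : Type*} (G : SimpleGraph V) (v : V) :
    (G.induce {v}).Connected := by
  rw [connected_induce_iff_cut]
  refine ⟨⟨v, rfl⟩, ?_⟩
  rintro T hT ⟨x, hx⟩ ⟨y, hy, hyT⟩
  have h1 := hT hx
  simp only [Set.mem_singleton_iff] at h1 hy
  subst h1 hy
  exact absurd hx hyT

/-- A set is connected if each of its vertices other than `t` has a neighbour of smaller rank in
the set. -/
theorem connected_induce_of_rank {V : Type*} {G : SimpleGraph V} {S : Set V} {t : V} (ht : t ∈ S)
    (d : V → ℕ) (h : ∀ v ∈ S, v ≠ t → ∃ u ∈ S, G.Adj u v ∧ d u < d v) :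
    (G.induce S).Connected := by
  rw [SimpleGraph.connected_iff_exists_forall_reachable]
  refine ⟨⟨t, ht⟩, ?_⟩
  have key : ∀ n, ∀ v (hv : v ∈ S), d v = n → (G.induce S).Reachable ⟨t, ht⟩ ⟨v, hv⟩ := by
    intro n
    induction n using Nat.strong_induction_on with
    | _ n ih =>
      intro v hv hn
      by_cases hvt : v = t
      · subst hvt; exact .rfl
      · obtain ⟨u, hu, huv, hlt⟩ := h v hv hvt
        exact (ih (d u) (hn ▸ hlt) u hu rfl).trans (SimpleGraph.Adj.reachable (G := G.induce S)
          (u := ⟨u, hu⟩) (v := ⟨v, hv⟩) huv)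
  exact fun v => key _ v.1 v.2 rfl

/-- The connected component of `y` in a vertex set `S`. -/
theorem exists_component {V : Type*} (G : SimpleGraph V) {S : Set V} {y : V} (hy : y ∈ S) :
    ∃ K ⊆ S, y ∈ K ∧ (G.induce K).Connected ∧ ∀ u ∈ K, ∀ v ∈ S, G.Adj u v → v ∈ K := by
  let K : Set V := {v | ∃ hv : v ∈ S, (G.induce S).Reachable ⟨y, hy⟩ ⟨v, hv⟩}
  have hclosed : ∀ u ∈ K, ∀ v ∈ S, G.Adj u v → v ∈ K := by
    rintro u ⟨hu, h⟩ v hv huv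
    exact ⟨hv, h.trans (SimpleGraph.Adj.reachable (G := G.induce S)
      (u := ⟨u, hu⟩) (v := ⟨v, hv⟩) huv)⟩
  have hyK : y ∈ K := ⟨hy, .rfl⟩
  refine ⟨K, fun v hv => hv.1, hyK, ?_, hclosed⟩
  rw [SimpleGraph.connected_iff_exists_forall_reachable]
  refine ⟨⟨y, hyK⟩, ?_⟩
  rintro ⟨v, hvS, hv⟩
  rw [SimpleGraph.reachable_iff_reflTransGen] at hv
  have key : ∀ b : S, Relation.ReflTransGen (G.induce S).Adj ⟨y, hy⟩ b →
      ∃ hb : b.1 ∈ K, (G.induce K).Reachable ⟨y, hyK⟩ ⟨b.1, hb⟩ := by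
    intro b hb
    induction hb with
    | refl => exact ⟨hyK, .rfl⟩
    | @tail b c _ hbc ih =>
      obtain ⟨hbK, hb⟩ := ih
      have hcK := hclosed _ hbK _ c.2 hbc
      exact ⟨hcK, hb.trans (SimpleGraph.Adj.reachable (G := G.induce K)
        (u := ⟨b.1, hbK⟩) (v := ⟨c.1, hcK⟩) hbc)⟩
  exact (key _ hv).2

/-! ### Forests -/

theorem not_reachable_of_isAcyclic {V : Type*} {F : SimpleGraph V} (hF : F.IsAcyclic) {x y : V}
    (h : F.Adj x y) : ¬ (F.deleteEdges {s(x, y)}).Reachable x y :=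
  SimpleGraph.isBridge_iff.1 (SimpleGraph.isAcyclic_iff_forall_adj_isBridge.1 hF h)

theorem isAcyclic_of_not_reachable {V : Type*} {F : SimpleGraph V}
    (h : ∀ x y, F.Adj x y → ¬ (F.deleteEdges {s(x, y)}).Reachable x y) : F.IsAcyclic :=
  SimpleGraph.isAcyclic_iff_forall_adj_isBridge.2 fun _ _ hxy =>
    SimpleGraph.isBridge_iff.2 (h _ _ hxy)

/-- Contracting pairwise disjoint connected sets of a forest yields a forest: a cycle through the
edge between two bags would lift to a cycle of the forest. -/
theorem isAcyclic_bagGraph {V W : Type} {F : SimpleGraph V} (hF : F.IsAcyclic) (B : W → Set V)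
    (hconn : ∀ a, (F.induce (B a)).Connected)
    (hdisj : ∀ a b, a ≠ b → Disjoint (B a) (B b)) : (bagGraph F B).IsAcyclic := by
  have huniq : ∀ {a b x}, x ∈ B a → x ∈ B b → a = b := by
    intro a b x ha hb
    by_contra hab
    exact Set.disjoint_left.1 (hdisj a b hab) ha hb
  refine isAcyclic_of_not_reachable ?_
  rintro a b ⟨hab, x, hx, y, hy, hxy⟩ hreach
  refine not_reachable_of_isAcyclic hF hxy ?_
  have hin : ∀ c, ∀ p ∈ B c, ∀ q ∈ B c, (F.deleteEdges {s(x, y)}).Reachable p q := by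
    intro c p hp q hq
    have := (hconn c).preconnected ⟨p, hp⟩ ⟨q, hq⟩
    refine reachable_of_map (fun v : B c => v.1) ?_ this
    rintro ⟨u, hu⟩ ⟨v, hv⟩ huv
    refine SimpleGraph.Adj.reachable ?_
    rw [SimpleGraph.deleteEdges_adj]
    refine ⟨huv, fun he => hab ?_⟩
    simp only [Set.mem_singleton_iff, Sym2.eq_iff] at he
    rcases he with ⟨rfl, rfl⟩ | ⟨rfl, rfl⟩
    · rw [huniq hx hu, huniq hy hv]
    · rw [huniq hx hv, huniq hy hu]
  rw [SimpleGraph.reachable_iff_reflTransGen] at hreach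
  have key : ∀ c, Relation.ReflTransGen ((bagGraph F B).deleteEdges {s(a, b)}).Adj a c →
      ∀ p ∈ B a, ∀ q ∈ B c, (F.deleteEdges {s(x, y)}).Reachable p q := by
    intro c hc
    induction hc with
    | refl => exact hin a
    | @tail c d _ hcd ih =>
      intro p hp q hq
      rw [SimpleGraph.deleteEdges_adj] at hcd
      obtain ⟨⟨hne, p', hp', q', hq', hpq⟩, hcd⟩ := hcd
      refine ((ih p hp p' hp').trans (SimpleGraph.Adj.reachable ?_)).trans (hin d q' hq' q hq)
      rw [SimpleGraph.deleteEdges_adj]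
      refine ⟨hpq, fun he => hcd ?_⟩
      simp only [Set.mem_singleton_iff, Sym2.eq_iff] at he ⊢
      rcases he with ⟨rfl, rfl⟩ | ⟨rfl, rfl⟩
      · exact Or.inl ⟨huniq hp' hx, huniq hq' hy⟩
      · exact Or.inr ⟨huniq hp' hy, huniq hq' hx⟩
  exact key b hreach x hx y hy

/-- A graph in which every vertex has at most one neighbour of at most its own rank is a
forest. -/
theorem isAcyclic_of_rank {V : Type*} {F : SimpleGraph V} (d : V → ℕ)
    (h : ∀ v u w, F.Adj v u → F.Adj v w → d u ≤ d v → d w ≤ d v → u = w) : F.IsAcyclic := by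
  classical
  intro v c hc
  obtain ⟨m, hm, hmax⟩ := c.support.toFinset.exists_max_image d
    ⟨v, by simp⟩
  have hm' : m ∈ c.support := by simpa using hm
  have hc' := hc.rotate hm'
  have hle : ∀ u ∈ (c.rotate m hm').support, d u ≤ d m := by
    intro u hu
    refine hmax u ?_
    simpa using (SimpleGraph.Walk.mem_support_rotate_iff _ _ _).1 hu
  refine hc'.snd_ne_penultimate (h m _ _ (SimpleGraph.Walk.adj_snd hc'.not_nil)
    (SimpleGraph.Walk.adj_penultimate hc'.not_nil).symm (hle _ ?_) (hle _ ?_))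
  · exact SimpleGraph.Walk.getVert_mem_support _ _
  · exact SimpleGraph.Walk.getVert_mem_support _ _

/-! ### Identifications as maps to forests -/

/-- `IdfOn G S m` says that identifying at most `m` vertices makes `G[S]` a forest, in terms of
maps: there is a map `f` from the vertices to those of a forest `F` that sends adjacent vertices
of `S` to equal or adjacent vertices and is injective on `S` but for at most `m` vertices. -/
def IdfOn {V : Type} (G : SimpleGraph V) (S : Set V) (m : ℕ) : Prop :=
  ∃ (W : Type) (F : SimpleGraph W) (f : V → W), F.IsAcyclic ∧
    (∀ u ∈ S, ∀ v ∈ S, G.Adj u v → f u = f v ∨ F.Adj (f u) (f v)) ∧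
    {v | v ∈ S ∧ ∃ u ∈ S, u ≠ v ∧ f u = f v}.ncard ≤ m

theorem IdfOn.mono {V : Type} {G : SimpleGraph V} {S : Set V} {m n : ℕ} (h : IdfOn G S m)
    (hmn : m ≤ n) : IdfOn G S n := by
  obtain ⟨W, F, f, h1, h2, h3⟩ := h
  exact ⟨W, F, f, h1, h2, h3.trans hmn⟩

theorem idfOn_univ_idf (G : FinGraph) : IdfOn G.graph Set.univ (idf G) := by
  classical
  obtain ⟨P, ⟨-, hdis⟩, hcard, hac⟩ := admits_idf G
  let f : G.V → (identifyPartition G P).V := fun v =>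
    if h : v ∈ ⋃₀ P then Sum.inr ⟨h.choose, h.choose_spec.1⟩ else Sum.inl ⟨v, h⟩
  have hf1 : ∀ v (h : v ∉ ⋃₀ P), f v = Sum.inl ⟨v, h⟩ := fun v h => dif_neg h
  have hmem : ∀ v, v ∈ Sum.elim (fun v : {v : G.V // v ∉ ⋃₀ P} => ({v.1} : Set G.V))
      (fun S : P => S.1) (f v) := by
    intro v
    by_cases h : v ∈ ⋃₀ P
    · simp only [f, dif_pos h]
      exact h.choose_spec.2
    · simp [hf1 v h]
  refine ⟨_, (identifyPartition G P).graph, f, hac, ?_, ?_⟩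
  · intro u _ v _ huv
    by_cases h : f u = f v
    · exact Or.inl h
    · exact Or.inr ⟨h, u, hmem u, v, hmem v, huv⟩
  · rw [← hcard]
    refine Set.ncard_le_ncard ?_ (Set.toFinite _)
    rintro v ⟨-, u, -, huv, hf⟩
    by_contra hv
    rw [hf1 v hv] at hf
    have := hmem u
    rw [hf] at this
    exact huv this

theorem idf_le_iff {G : FinGraph} {m : ℕ} : idf G ≤ m ↔ IdfOn G.graph Set.univ m := by
  constructor
  · exact fun h => (idfOn_univ_idf G).mono h
  rintro ⟨W, F, f, hF, hf, hcard⟩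
  refine le_trans ?_ hcard
  let P : Set (Set G.V) := {S | ∃ v, (∃ u, u ≠ v ∧ f u = f v) ∧ S = {u | f u = f v}}
  have hP : ⋃₀ P = {v | v ∈ Set.univ ∧ ∃ u ∈ Set.univ, u ≠ v ∧ f u = f v} := by
    ext w
    simp only [Set.mem_sUnion, Set.mem_univ, true_and, Set.mem_ofPred_eq, P]
    constructor
    · rintro ⟨_, ⟨v, ⟨u, huv, hf⟩, rfl⟩, hw⟩
      by_cases hvw : v = w
      · subst hvw; exact ⟨u, huv, hf⟩
      · exact ⟨v, hvw, hw.symm⟩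
    · rintro hw
      exact ⟨_, ⟨w, hw, rfl⟩, rfl⟩
  refine Nat.sInf_le ⟨P, ⟨?_, ?_⟩, by rw [hP], ?_⟩
  · rintro ⟨v, -, h⟩
    exact (h ▸ (rfl : f v = f v) : v ∈ (∅ : Set G.V))
  · rintro _ ⟨v, -, rfl⟩ _ ⟨w, -, rfl⟩ hne
    refine Set.disjoint_left.2 fun x hx hy => hne ?_
    have hx : f x = f v := hx
    have hy : f x = f w := hy
    simp [← hx, ← hy]
  · let B := Sum.elim (fun v : {v : G.V // v ∉ ⋃₀ P} => ({v.1} : Set G.V)) (fun S : P => S.1)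
    have hne : ∀ z, ∃ v, v ∈ B z := by
      rintro (v | ⟨_, v, -, rfl⟩)
      · exact ⟨v.1, rfl⟩
      · exact ⟨v, rfl⟩
    choose g hg using hne
    have hB : ∀ z, ∀ v ∈ B z, f v = f (g z) := by
      rintro (v | ⟨_, v, hv, rfl⟩) w hw
      · have h1 : g (Sum.inl v) = v.1 := hg (Sum.inl v)
        have h2 : w = v.1 := hw
        rw [h1, h2]
      · have h1 : f (g (Sum.inr ⟨_, v, hv, rfl⟩)) = f v := hg (Sum.inr ⟨_, v, hv, rfl⟩)
        have h2 : f w = f v := hw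
        rw [h1, h2]
    have hinj : ∀ z z', f (g z) = f (g z') → z = z' := by
      have hout : ∀ v : {v : G.V // v ∉ ⋃₀ P}, ∀ u, f u = f v.1 → u = v.1 := by
        intro v u huv
        by_contra hne
        exact v.2 ⟨_, ⟨v, ⟨u, hne, huv⟩, rfl⟩, rfl⟩
      rintro (v | ⟨_, v, hv, rfl⟩) (w | ⟨_, w, hw, rfl⟩) h
      · have h1 : g (Sum.inl v) = v.1 := hg (Sum.inl v)
        have h2 : g (Sum.inl w) = w.1 := hg (Sum.inl w)
        rw [h1, h2] at h
        rw [Subtype.ext (hout w _ h)]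
      · have h1 : g (Sum.inl v) = v.1 := hg (Sum.inl v)
        have h2 := hg (Sum.inr ⟨_, w, hw, rfl⟩)
        rw [h1] at h
        rw [hout v _ h.symm] at h2
        exact absurd ⟨_, ⟨w, hw, rfl⟩, h2⟩ v.2
      · have h1 : g (Sum.inl w) = w.1 := hg (Sum.inl w)
        have h2 := hg (Sum.inr ⟨_, v, hv, rfl⟩)
        rw [h1] at h
        rw [hout w _ h] at h2
        exact absurd ⟨_, ⟨v, hv, rfl⟩, h2⟩ w.2
      · have h1 : f (g (Sum.inr ⟨_, v, hv, rfl⟩)) = f v := hg (Sum.inr ⟨_, v, hv, rfl⟩)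
        have h2 : f (g (Sum.inr ⟨_, w, hw, rfl⟩)) = f w := hg (Sum.inr ⟨_, w, hw, rfl⟩)
        rw [h1, h2] at h
        congr 2
        simp [h]
    change (bagGraph G.graph B).IsAcyclic
    refine SimpleGraph.IsAcyclic.comap (G' := F) ⟨fun z => f (g z), ?_⟩ hinj hF
    rintro a b ⟨hab, x, hx, y, hy, hxy⟩
    rw [← hB a x hx, ← hB b y hy]
    refine (hf x trivial y trivial hxy).resolve_left fun h => hab ?_
    rw [hB a x hx, hB b y hy] at h
    exact hinj _ _ h

/-! ### Bounds on the order of an identification -/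

/-- Identifying a vertex cover leaves a star. -/
theorem idfOn_of_cover {V : Type} [Finite V] {G : SimpleGraph V} {S X : Set V} {m : ℕ}
    (hX : ∀ u ∈ S, ∀ v ∈ S, G.Adj u v → u ∈ X ∨ v ∈ X)
    (hm : X.ncard ≤ m ∨ X.ncard ≤ 1) : IdfOn G S m := by
  classical
  let f : V → Option V := fun v => if v ∈ X then none else some v
  have hf : ∀ v u, u ≠ v → f u = f v → u ∈ X ∧ v ∈ X := by
    intro v u huv h
    by_cases hu : u ∈ X <;> by_cases hv : v ∈ X <;> simp_all [f]
  refine ⟨Option V, SimpleGraph.starGraph none, f, SimpleGraph.isAcyclic_starGraph _, ?_, ?_⟩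
  · intro u hu v hv huv
    by_cases h : f u = f v
    · exact Or.inl h
    · refine Or.inr (SimpleGraph.starGraph_adj.2 ⟨h, ?_⟩)
      rcases hX u hu v hv huv with h | h
      · exact Or.inl (if_pos h)
      · exact Or.inr (if_pos h)
  · rcases hm with hm | hm
    · refine (Set.ncard_le_ncard ?_ (Set.toFinite _)).trans hm
      rintro v ⟨-, u, -, huv, h⟩
      exact (hf v u huv h).2
    · have : {v | v ∈ S ∧ ∃ u ∈ S, u ≠ v ∧ f u = f v} = ∅ := by
        rw [Set.eq_empty_iff_forall_notMem]
        rintro v ⟨-, u, -, huv, h⟩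
        obtain ⟨h1, h2⟩ := hf v u huv h
        exact huv ((Set.ncard_le_one (Set.toFinite _)).1 hm _ h1 _ h2)
      rw [this, Set.ncard_empty]
      exact Nat.zero_le _

/-- If `G[A]` and `G[B]` share just the vertex `c`, identifications of both combine to one of
`G[A ∪ B]`. The two forests are glued at the images of `c`; the glued forest is realised as the
union of a fibre of each of the two projections of the product of the two vertex sets. -/
theorem idfOn_union {V : Type} [Finite V] {G : SimpleGraph V} {A B : Set V} {c : V} {m n : ℕ}
    (hA : IdfOn G A m) (hB : IdfOn G B n) (hcA : c ∈ A) (hcB : c ∈ B)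
    (hAB : ∀ v ∈ A, v ∈ B → v = c)
    (hadj : ∀ u ∈ A, ∀ v ∈ B, G.Adj u v → u = c ∨ v = c) : IdfOn G (A ∪ B) (m + n) := by
  classical
  obtain ⟨W, F, f, hF, hf, hm⟩ := hA
  obtain ⟨W', F', f', hF', hf', hn⟩ := hB
  let T : SimpleGraph (W × W') :=
    { Adj := fun p q => (p.2 = f' c ∧ q.2 = f' c ∧ F.Adj p.1 q.1) ∨
        (p.1 = f c ∧ q.1 = f c ∧ F'.Adj p.2 q.2)
      symm := ⟨by
        rintro p q (⟨h1, h2, h3⟩ | ⟨h1, h2, h3⟩)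
        · exact Or.inl ⟨h2, h1, h3.symm⟩
        · exact Or.inr ⟨h2, h1, h3.symm⟩⟩
      loopless := ⟨by
        rintro p (⟨_, _, h⟩ | ⟨_, _, h⟩)
        · exact h.ne rfl
        · exact h.ne rfl⟩ }
  let g : V → W := fun v => if v ∈ A then f v else f c
  let g' : V → W' := fun v => if v ∈ B then f' v else f' c
  have gA : ∀ v ∈ A, g v = f v := fun v hv => if_pos hv
  have gB : ∀ v ∈ B, g' v = f' v := fun v hv => if_pos hv
  have gB' : ∀ v ∈ A, g' v = f' c := by
    intro v hv
    by_cases h : v ∈ B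
    · rw [gB v h, hAB v hv h]
    · exact if_neg h
  have gA' : ∀ v ∈ B, g v = f c := by
    intro v hv
    by_cases h : v ∈ A
    · rw [gA v h, hAB v h hv]
    · exact if_neg h
  have hadjA : ∀ u ∈ A, ∀ v ∈ A, G.Adj u v → (g u, g' u) = (g v, g' v) ∨
      T.Adj (g u, g' u) (g v, g' v) := by
    intro u hu v hv huv
    rw [gB' u hu, gB' v hv, gA u hu, gA v hv]
    rcases hf u hu v hv huv with h | h
    · exact Or.inl (by rw [h])
    · exact Or.inr (Or.inl ⟨rfl, rfl, h⟩)
  have hadjB : ∀ u ∈ B, ∀ v ∈ B, G.Adj u v → (g u, g' u) = (g v, g' v) ∨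
      T.Adj (g u, g' u) (g v, g' v) := by
    intro u hu v hv huv
    rw [gA' u hu, gA' v hv, gB u hu, gB v hv]
    rcases hf' u hu v hv huv with h | h
    · exact Or.inl (by rw [h])
    · exact Or.inr (Or.inr ⟨rfl, rfl, h⟩)
  refine ⟨W × W', T, fun v => (g v, g' v), ?_, ?_, ?_⟩
  · refine isAcyclic_of_not_reachable ?_
    rintro p q (⟨h1, h2, h3⟩ | ⟨h1, h2, h3⟩) hr
    · refine not_reachable_of_isAcyclic hF h3 (reachable_of_map Prod.fst ?_ hr)
      intro x y hxy
      rw [SimpleGraph.deleteEdges_adj] at hxy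
      obtain ⟨⟨k1, k2, k3⟩ | ⟨k1, k2, k3⟩, hne⟩ := hxy
      · refine SimpleGraph.Adj.reachable ?_
        rw [SimpleGraph.deleteEdges_adj]
        refine ⟨k3, fun he => hne ?_⟩
        simp only [Set.mem_singleton_iff, Sym2.eq_iff, Prod.ext_iff] at he ⊢
        simpa [k1, k2, h1, h2] using he
      · rw [k1, k2]
    · refine not_reachable_of_isAcyclic hF' h3 (reachable_of_map Prod.snd ?_ hr)
      intro x y hxy
      rw [SimpleGraph.deleteEdges_adj] at hxy
      obtain ⟨⟨k1, k2, k3⟩ | ⟨k1, k2, k3⟩, hne⟩ := hxy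
      · rw [k1, k2]
      · refine SimpleGraph.Adj.reachable ?_
        rw [SimpleGraph.deleteEdges_adj]
        refine ⟨k3, fun he => hne ?_⟩
        simp only [Set.mem_singleton_iff, Sym2.eq_iff, Prod.ext_iff] at he ⊢
        simpa [k1, k2, h1, h2] using he
  · rintro u (hu | hu) v (hv | hv) huv
    · exact hadjA u hu v hv huv
    · rcases hadj u hu v hv huv with rfl | rfl
      · exact hadjB _ hcB v hv huv
      · exact hadjA u hu _ hcA huv
    · rcases hadj v hv u hu huv.symm with rfl | rfl
      · exact hadjB u hu _ hcB huv
      · exact hadjA _ hcA v hv huv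
    · exact hadjB u hu v hv huv
  · refine le_trans ?_ (Nat.add_le_add hm hn)
    refine le_trans (Set.ncard_le_ncard ?_ (Set.toFinite _)) (Set.ncard_union_le _ _)
    have hmix : ∀ u ∈ A, ∀ v ∈ B, g u = g v → g' u = g' v → f u = f c ∧ f' v = f' c := by
      intro u hu v hv h1 h2
      rw [gA u hu, gA' v hv] at h1
      rw [gB' u hu, gB v hv] at h2
      exact ⟨h1, h2.symm⟩
    rintro v ⟨hv, u, hu, huv, heq⟩
    obtain ⟨h1, h2⟩ := Prod.ext_iff.1 heq
    have h1 : g u = g v := h1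
    have h2 : g' u = g' v := h2
    rcases hv with hv | hv <;> rcases hu with hu | hu
    · rw [gA u hu, gA v hv] at h1
      exact Or.inl ⟨hv, u, hu, huv, h1⟩
    · obtain ⟨k1, k2⟩ := hmix v hv u hu h1.symm h2.symm
      by_cases hvc : v = c
      · subst hvc; exact Or.inr ⟨hcB, u, hu, huv, k2⟩
      · exact Or.inl ⟨hv, c, hcA, Ne.symm hvc, k1.symm⟩
    · obtain ⟨k1, k2⟩ := hmix u hu v hv h1 h2
      by_cases hvc : v = c
      · subst hvc; exact Or.inl ⟨hcA, u, hu, huv, k1⟩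
      · exact Or.inr ⟨hv, c, hcB, Ne.symm hvc, k2.symm⟩
    · rw [gB u hu, gB v hv] at h2
      exact Or.inr ⟨hv, u, hu, huv, h2⟩

/-- An identification to a forest moves an end of every edge that is not a bridge: the edges that
are not bridges have a vertex cover of size `idf G`. -/
theorem exists_cover_of_idf (G : FinGraph) : ∃ X : Set G.V, X.ncard ≤ idf G ∧
    ∀ u v, G.graph.Adj u v → (G.graph.deleteEdges {s(u, v)}).Reachable u v → u ∈ X ∨ v ∈ X := by
  obtain ⟨W, F, f, hF, hf, hcard⟩ := idfOn_univ_idf G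
  refine ⟨_, hcard, ?_⟩
  intro u v huv hr
  by_contra! hno
  have hu : ∀ x, f x = f u → x = u := by
    intro x hx
    by_contra hne
    exact hno.1 ⟨trivial, x, trivial, hne, hx⟩
  have hv : ∀ x, f x = f v → x = v := by
    intro x hx
    by_contra hne
    exact hno.2 ⟨trivial, x, trivial, hne, hx⟩
  have hadj : F.Adj (f u) (f v) :=
    (hf u trivial v trivial huv).resolve_left fun h => huv.ne (hv u h)
  refine not_reachable_of_isAcyclic hF hadj (reachable_of_map f ?_ hr)
  intro x y hxy
  rw [SimpleGraph.deleteEdges_adj] at hxy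
  rcases hf x trivial y trivial hxy.1 with h | h
  · rw [h]
  · refine SimpleGraph.Adj.reachable ?_
    rw [SimpleGraph.deleteEdges_adj]
    refine ⟨h, fun he => hxy.2 ?_⟩
    simp only [Set.mem_singleton_iff, Sym2.eq_iff] at he ⊢
    rcases he with ⟨h1, h2⟩ | ⟨h1, h2⟩
    · exact Or.inl ⟨hu _ h1, hv _ h2⟩
    · exact Or.inr ⟨hv _ h1, hu _ h2⟩

/-! ### Minors -/

theorem IsMinor.of_injective {H G : FinGraph} (f : H.V → G.V) (hf : Function.Injective f)
    (h : ∀ u v, H.graph.Adj u v → G.graph.Adj (f u) (f v)) : IsMinor H G := by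
  refine ⟨fun v => {f v}, fun v => connected_induce_singleton _ _, ?_, ?_⟩
  · intro v w hvw
    exact Set.disjoint_singleton.2 fun he => hvw (hf he)
  · intro v w hvw
    exact ⟨f v, rfl, f w, rfl, h v w hvw⟩

theorem IsMinor.trans {G₁ G₂ G₃ : FinGraph} (h₁ : IsMinor G₁ G₂) (h₂ : IsMinor G₂ G₃) :
    IsMinor G₁ G₃ := by
  obtain ⟨B, hBc, hBd, hB⟩ := h₁
  obtain ⟨C, hCc, hCd, hC⟩ := h₂
  refine ⟨fun v => {x | ∃ w ∈ B v, x ∈ C w}, ?_, ?_, ?_⟩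
  · intro v
    rw [connected_induce_iff_cut]
    obtain ⟨w₀, hw₀⟩ := (connected_induce_iff_cut.1 (hBc v)).1
    obtain ⟨x₀, hx₀⟩ := (connected_induce_iff_cut.1 (hCc w₀)).1
    refine ⟨⟨x₀, w₀, hw₀, hx₀⟩, ?_⟩
    rintro T hT ⟨x, hx⟩ ⟨y, ⟨w', hw', hyw'⟩, hyT⟩
    obtain ⟨w, hw, hxw⟩ := hT hx
    by_contra! hno
    have hall : ∀ w ∈ B v, (∃ x ∈ C w, x ∈ T) → C w ⊆ T := by
      rintro w hw ⟨x, hxw, hx⟩ y hy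
      by_contra hyT
      obtain ⟨p, hp, q, hq, hpq⟩ := (connected_induce_iff_cut.1 (hCc w)).2 (C w ∩ T)
        Set.inter_subset_left ⟨x, hxw, hx⟩ ⟨y, hy, fun h => hyT h.2⟩
      exact hno p hp.2 q ⟨⟨w, hw, hq.1⟩, fun h => hq.2 ⟨hq.1, h⟩⟩ hpq
    obtain ⟨p, ⟨hp, hpT⟩, q, ⟨hq, hqT⟩, hpq⟩ := (connected_induce_iff_cut.1 (hBc v)).2
      {w | w ∈ B v ∧ C w ⊆ T} (fun w hw => hw.1) ⟨w, hw, hall w hw ⟨x, hxw, hx⟩⟩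
      ⟨w', hw', fun h => hyT (h.2 hyw')⟩
    obtain ⟨a, ha, b, hb, hab⟩ := hC p q hpq
    refine hno a (hpT ha) b ⟨⟨q, hq, hb⟩, fun h => hqT ⟨hq, hall q hq ⟨b, hb, h⟩⟩⟩ hab
  · intro v w hvw
    refine Set.disjoint_left.2 ?_
    rintro x ⟨a, ha, hxa⟩ ⟨b, hb, hxb⟩
    have hab : a = b := by
      by_contra hab
      exact Set.disjoint_left.1 (hCd a b hab) hxa hxb
    subst hab
    exact Set.disjoint_left.1 (hBd v w hvw) ha hb
  · intro v w hvw
    obtain ⟨p, hp, q, hq, hpq⟩ := hB v w hvw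
    obtain ⟨a, ha, b, hb, hab⟩ := hC p q hpq
    exact ⟨a, ⟨p, hp, ha⟩, b, ⟨q, hq, hb⟩, hab⟩

/-- Given a map `f` of `G` to a forest `F` and a model of `H` in `G`, the images of the branch
sets are connected in `F`. Contracting the unions of the chains of meeting images gives a forest,
to which `H` maps. A vertex of `H` shares its image with another one only if its branch set
contains a vertex at which `f` is not injective. -/
theorem minorMonotone_idf : MinorMonotone idf := by
  rintro H G ⟨B, hBc, hBd, hB⟩
  obtain ⟨W, F, f, hF, hf, hcard⟩ := idfOn_univ_idf G
  rw [idf_le_iff]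
  let r : H.V → H.V → Prop := fun h h' => ∃ x ∈ B h, ∃ y ∈ B h', f x = f y
  let C : Quot r → Set W := fun q => {w | ∃ h, Quot.mk r h = q ∧ ∃ x ∈ B h, f x = w}
  have hCc : ∀ q, (F.induce (C q)).Connected := by
    intro q
    rw [connected_induce_iff_cut]
    obtain ⟨h₀, rfl⟩ := Quot.exists_rep q
    obtain ⟨x₀, hx₀⟩ := (connected_induce_iff_cut.1 (hBc h₀)).1
    refine ⟨⟨f x₀, h₀, rfl, x₀, hx₀, rfl⟩, ?_⟩
    rintro T hT ⟨w, hw⟩ ⟨w', ⟨h', hh', x', hx', rfl⟩, hw'⟩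
    obtain ⟨h, hh, x, hx, rfl⟩ := hT hw
    by_contra! hno
    have hall : ∀ k, Quot.mk r k = Quot.mk r h₀ → ∀ x ∈ B k, f x ∈ T → ∀ y ∈ B k, f y ∈ T := by
      intro k hk x hx hxT y hy
      by_contra hyT
      obtain ⟨p, hp, q, hq, hpq⟩ := (connected_induce_iff_cut.1 (hBc k)).2 {z | z ∈ B k ∧ f z ∈ T}
        (fun z hz => hz.1) ⟨x, hx, hxT⟩ ⟨y, hy, fun h => hyT h.2⟩
      have hqT : f q ∉ T := fun h => hq.2 ⟨hq.1, h⟩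
      refine hno (f p) hp.2 (f q) ⟨⟨k, hk, q, hq.1, rfl⟩, hqT⟩ ?_
      exact (hf p trivial q trivial hpq).resolve_left fun h => hqT (h ▸ hp.2)
    let P : H.V → Prop := fun k => Quot.mk r k = Quot.mk r h₀ ∧ ∃ y ∈ B k, f y ∈ T
    have hP : ∀ k k', r k k' → P k = P k' := by
      rintro k k' ⟨y, hy, y', hy', hyy⟩
      have hkk : Quot.mk r k = Quot.mk r k' := Quot.sound ⟨y, hy, y', hy', hyy⟩
      refine propext ⟨?_, ?_⟩
      · rintro ⟨h1, z, hz, hzT⟩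
        exact ⟨hkk ▸ h1, y', hy', hyy ▸ hall k h1 z hz hzT y hy⟩
      · rintro ⟨h1, z, hz, hzT⟩
        exact ⟨hkk.trans h1, y, hy, hyy.symm ▸ hall k' h1 z hz hzT y' hy'⟩
    have h1 : P h = P h' := congrArg (Quot.lift P hP) (hh.trans hh'.symm)
    have h2 : P h' := h1 ▸ ⟨hh, x, hx, hw⟩
    obtain ⟨-, z, hz, hzT⟩ := h2
    exact hw' (hall h' hh' z hz hzT x' hx')
  refine ⟨Quot r, bagGraph F C, Quot.mk r, isAcyclic_bagGraph hF C hCc ?_, ?_, ?_⟩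
  · intro q q' hqq
    refine Set.disjoint_left.2 ?_
    rintro w ⟨h, rfl, x, hx, rfl⟩ ⟨h', rfl, y, hy, hyx⟩
    exact hqq (Quot.sound ⟨x, hx, y, hy, hyx.symm⟩)
  · intro h _ h' _ hadj
    obtain ⟨x, hx, y, hy, hxy⟩ := hB h h' hadj
    rcases hf x trivial y trivial hxy with he | he
    · exact Or.inl (Quot.sound ⟨x, hx, y, hy, he⟩)
    · by_cases hq : Quot.mk r h = Quot.mk r h'
      · exact Or.inl hq
      · exact Or.inr ⟨hq, f x, ⟨h, rfl, x, hx, rfl⟩, f y, ⟨h', rfl, y, hy, rfl⟩, he⟩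
  · refine le_trans ?_ hcard
    have key : ∀ h ∈ {v | v ∈ Set.univ ∧ ∃ u ∈ Set.univ, u ≠ v ∧ Quot.mk r u = Quot.mk r v},
        ∃ x, x ∈ B h ∧ ∃ u, u ≠ x ∧ f u = f x := by
      rintro h ⟨-, h', -, hne, hq⟩
      have hex : ∃ h'', h'' ≠ h ∧ r h h'' := by
        by_contra! hno
        have hP : ∀ k k', r k k' → (k = h) = (k' = h) := by
          rintro k k' hk
          have hk' : r k' k := by
            obtain ⟨x, hx, y, hy, hxy⟩ := hk
            exact ⟨y, hy, x, hx, hxy.symm⟩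
          refine propext ⟨?_, ?_⟩
          · rintro rfl
            by_contra hne
            exact hno k' hne hk
          · rintro rfl
            by_contra hne
            exact hno k hne hk'
        have h1 : (h' = h) = (h = h) := congrArg (Quot.lift (fun k => k = h) hP) hq
        exact hne (h1 ▸ rfl)
      obtain ⟨h'', hne, x, hx, y, hy, hxy⟩ := hex
      refine ⟨x, hx, y, ?_, hxy.symm⟩
      rintro rfl
      exact Set.disjoint_left.1 (hBd _ _ hne) hy hx
    have key' : ∀ h, ∃ x, h ∈ {v | v ∈ Set.univ ∧ ∃ u ∈ Set.univ, u ≠ v ∧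
        Quot.mk r u = Quot.mk r v} → x ∈ B h ∧ ∃ u, u ≠ x ∧ f u = f x := by
      intro h
      by_cases hh : h ∈ {v | v ∈ Set.univ ∧ ∃ u ∈ Set.univ, u ≠ v ∧ Quot.mk r u = Quot.mk r v}
      · obtain ⟨x, hx⟩ := key h hh
        exact ⟨x, fun _ => hx⟩
      · obtain ⟨x, -⟩ := (connected_induce_iff_cut.1 (hBc h)).1
        exact ⟨x, fun h => absurd h hh⟩
    choose g hg using key'
    refine Set.ncard_le_ncard_of_injOn g ?_ ?_ (Set.toFinite _)
    · intro h hh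
      obtain ⟨u, hu⟩ := (hg h hh).2
      exact ⟨trivial, u, trivial, hu⟩
    · intro h hh h' hh' he
      by_contra hne
      exact Set.disjoint_left.1 (hBd _ _ hne) (hg h hh).1 (he ▸ (hg h' hh').1)

/-! ### Models of the three families -/

/-- `G` has a model of a triangle all of whose branch sets lie in `S`. -/
def TriangleIn {V : Type} (G : SimpleGraph V) (S : Set V) : Prop :=
  ∃ B : Fin 3 → Set V, (∀ i, B i ⊆ S) ∧ (∀ i, (G.induce (B i)).Connected) ∧
    (∀ i j, i ≠ j → Disjoint (B i) (B j)) ∧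
    ∀ i j, i ≠ j → ∃ x ∈ B i, ∃ y ∈ B j, G.Adj x y

/-- `D` is connected and has two distinct vertices with neighbours in `Z`: with `Z` contracted,
`D` contains a triangle through the vertex `Z`. -/
def IsPetal {V : Type} (G : SimpleGraph V) (Z D : Set V) : Prop :=
  (G.induce D).Connected ∧ ∃ x ∈ D, ∃ y ∈ D, x ≠ y ∧ (∃ z ∈ Z, G.Adj z x) ∧ ∃ z ∈ Z, G.Adj z y

theorem IsPetal.exists_split {V : Type} {G : SimpleGraph V} {Z D : Set V} (h : IsPetal G Z D) :
    ∃ x ∈ D, ∃ K ⊆ D, x ∉ K ∧ (G.induce K).Connected ∧ (∃ y ∈ K, G.Adj x y) ∧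
      (∃ z ∈ Z, G.Adj z x) ∧ ∃ z ∈ Z, ∃ y ∈ K, G.Adj z y := by
  obtain ⟨hD, x, hx, y, hy, hxy, hzx, z, hz, hzy⟩ := h
  obtain ⟨K, hKD, hyK, hK, hcl⟩ := exists_component G (S := D \ {x}) (y := y) ⟨hy, Ne.symm hxy⟩
  have hxK : x ∉ K := fun h => (hKD h).2 rfl
  refine ⟨x, hx, K, fun v hv => (hKD hv).1, hxK, hK, ?_, hzx, z, hz, y, hyK, hzy⟩
  obtain ⟨p, hp, q, ⟨hqD, hqK⟩, hpq⟩ := (connected_induce_iff_cut.1 hD).2 K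
    (fun v hv => (hKD hv).1) ⟨y, hyK⟩ ⟨x, hx, hxK⟩
  have hqx : q = x := by
    by_contra hne
    exact hqK (hcl p hp q ⟨hqD, hne⟩ hpq)
  exact ⟨p, hp, hqx ▸ hpq.symm⟩

theorem TriangleIn.of_sets {V : Type} {G : SimpleGraph V} {S P Q R : Set V}
    (hP : P ⊆ S) (hQ : Q ⊆ S) (hR : R ⊆ S) (cP : (G.induce P).Connected)
    (cQ : (G.induce Q).Connected) (cR : (G.induce R).Connected)
    (dPQ : Disjoint P Q) (dPR : Disjoint P R) (dQR : Disjoint Q R)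
    (ePQ : ∃ x ∈ P, ∃ y ∈ Q, G.Adj x y) (ePR : ∃ x ∈ P, ∃ y ∈ R, G.Adj x y)
    (eQR : ∃ x ∈ Q, ∃ y ∈ R, G.Adj x y) : TriangleIn G S := by
  have sw : ∀ {A B : Set V}, (∃ x ∈ A, ∃ y ∈ B, G.Adj x y) → ∃ x ∈ B, ∃ y ∈ A, G.Adj x y := by
    rintro A B ⟨x, hx, y, hy, h⟩
    exact ⟨y, hy, x, hx, h.symm⟩
  refine ⟨![P, Q, R], ?_, ?_, ?_, ?_⟩
  · intro i; fin_cases i <;> assumption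
  · intro i; fin_cases i <;> assumption
  · intro i j hij
    fin_cases i <;> fin_cases j <;> first | exact absurd rfl hij | assumption | (symm; assumption)
  · intro i j hij
    fin_cases i <;> fin_cases j <;>
      first | exact absurd rfl hij | assumption | (apply sw; assumption)

theorem IsPetal.triangleIn {V : Type} {G : SimpleGraph V} {Z D S : Set V} (h : IsPetal G Z D)
    (hZ : (G.induce Z).Connected) (hdisj : Disjoint Z D) (hZS : Z ⊆ S) (hDS : D ⊆ S) :
    TriangleIn G S := by
  obtain ⟨x, hx, K, hKD, hxK, hK, hxy, ⟨z, hz, hzx⟩, hzK⟩ := h.exists_split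
  exact TriangleIn.of_sets hZS (Set.singleton_subset_iff.2 (hDS hx)) (hKD.trans hDS) hZ
    (connected_induce_singleton _ x) hK (hdisj.mono_right (Set.singleton_subset_iff.2 hx))
    (hdisj.mono_right hKD) (Set.disjoint_singleton_left.2 hxK) ⟨z, hz, x, rfl, hzx⟩ hzK
    ⟨x, rfl, hxy⟩

theorem isMinor_triangles {G : FinGraph} {k : ℕ} (S : Fin k → Set G.V)
    (hdisj : ∀ i j, i ≠ j → Disjoint (S i) (S j)) (hS : ∀ i, TriangleIn G.graph (S i)) :
    IsMinor (triangles k) G := by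
  choose B hBS hBc hBd hB using hS
  refine ⟨fun v => B v.1 v.2, fun v => hBc _ _, ?_, ?_⟩
  · rintro ⟨i, a⟩ ⟨j, b⟩ hne
    by_cases hij : i = j
    · subst hij
      exact hBd i a b fun h => hne (by rw [h])
    · exact (hdisj i j hij).mono (hBS i a) (hBS j b)
  · rintro ⟨i, a⟩ ⟨j, b⟩ ⟨hij, hab⟩
    obtain rfl : i = j := hij
    exact hB i a b hab

/-- The vertex shared by the triangles of the marguerite. -/
def margCenter (k : ℕ) : (marguerite k).V := Sum.inr ()

/-- The two vertices of the `i`-th triangle of the marguerite other than the centre. -/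
def margPetal {k : ℕ} (i : Fin k) (b : Bool) : (marguerite k).V :=
  Sum.inl ⟨(i, if b then 1 else 2), by cases b <;> simp⟩

theorem marg_cases {k : ℕ} (v : (marguerite k).V) :
    v = margCenter k ∨ ∃ i b, v = margPetal i b := by
  obtain ⟨⟨i, j⟩, hj⟩ | _ := v
  · refine Or.inr ?_
    have hj' : j ≠ 0 := hj
    have : j = 1 ∨ j = 2 := by omega
    rcases this with rfl | rfl
    · exact ⟨i, true, rfl⟩
    · exact ⟨i, false, rfl⟩
  · exact Or.inl rfl

theorem margPetal_ne_center {k : ℕ} (i : Fin k) (b : Bool) : margPetal i b ≠ margCenter k :=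
  Sum.inl_ne_inr

theorem margPetal_inj {k : ℕ} {i j : Fin k} {b c : Bool} :
    margPetal i b = margPetal j c ↔ i = j ∧ b = c := by
  refine ⟨fun h => ?_, fun h => by rw [h.1, h.2]⟩
  have h1 := Prod.ext_iff.1 (Subtype.ext_iff.1 (Sum.inl_injective h))
  refine ⟨h1.1, ?_⟩
  have h2 := h1.2
  cases b <;> cases c <;> simp at h2 ⊢

theorem marg_adj_center {k : ℕ} (i : Fin k) (b : Bool) :
    (marguerite k).graph.Adj (margCenter k) (margPetal i b) :=
  ⟨(margPetal_ne_center i b).symm, (i, 0), rfl, _, rfl, rfl, by cases b <;> simp⟩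

theorem marg_adj_petal {k : ℕ} {i j : Fin k} {b c : Bool} :
    (marguerite k).graph.Adj (margPetal i b) (margPetal j c) ↔ i = j ∧ b ≠ c := by
  constructor
  · rintro ⟨hne, x, hx, y, hy, hxy, -⟩
    have hx : x = (i, if b then 1 else 2) := hx
    have hy : y = (j, if c then 1 else 2) := hy
    have hij : i = j := by rw [hx, hy] at hxy; exact hxy
    refine ⟨hij, ?_⟩
    rintro rfl
    exact hne (by rw [hij])
  · rintro ⟨rfl, hbc⟩
    refine ⟨fun h => hbc (margPetal_inj.1 h).2, _, rfl, _, rfl, rfl, ?_⟩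
    cases b <;> cases c <;> simp at hbc ⊢

theorem isMinor_marguerite {G : FinGraph} {k : ℕ} {Z : Set G.V} (hZ : (G.graph.induce Z).Connected)
    (D : Fin k → Set G.V) (hD : ∀ i, IsPetal G.graph Z (D i))
    (hdisj : ∀ i j, i ≠ j → Disjoint (D i) (D j)) (hZD : ∀ i, Disjoint Z (D i)) :
    IsMinor (marguerite k) G := by
  choose x hx K hKD hxK hK hxy hzx hzK using fun i => (hD i).exists_split
  let B : (marguerite k).V → Set G.V := Sum.elim (fun v => if v.1.2 = 1 then {x v.1.1} else K v.1.1)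
    (fun _ => Z)
  have hB1 : ∀ i, B (margPetal i true) = {x i} := fun i => by simp [B, margPetal]
  have hB2 : ∀ i, B (margPetal i false) = K i := fun i => by simp [B, margPetal]
  have hBD : ∀ i b, B (margPetal i b) ⊆ D i := by
    rintro i (_ | _)
    · rw [hB2]; exact hKD i
    · rw [hB1]; exact Set.singleton_subset_iff.2 (hx i)
  refine ⟨B, ?_, ?_, ?_⟩
  · intro v
    rcases marg_cases v with rfl | ⟨i, _ | _, rfl⟩
    · exact hZ
    · rw [hB2]; exact hK i
    · rw [hB1]; exact connected_induce_singleton _ _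
  · intro v w hvw
    rcases marg_cases v with rfl | ⟨i, b, rfl⟩ <;> rcases marg_cases w with rfl | ⟨j, c, rfl⟩
    · exact absurd rfl hvw
    · exact (hZD j).mono_right (hBD j c)
    · exact ((hZD i).mono_right (hBD i b)).symm
    · by_cases hij : i = j
      · subst hij
        cases b <;> cases c
        · exact absurd rfl hvw
        · rw [hB1, hB2]; exact Set.disjoint_singleton_right.2 (hxK i)
        · rw [hB1, hB2]; exact Set.disjoint_singleton_left.2 (hxK i)
        · exact absurd rfl hvw
      · exact (hdisj i j hij).mono (hBD i b) (hBD j c)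
  · have hc : ∀ i b, ∃ p ∈ B (margCenter k), ∃ q ∈ B (margPetal i b), G.graph.Adj p q := by
      rintro i (_ | _)
      · rw [hB2]; exact hzK i
      · obtain ⟨z, hz, h⟩ := hzx i
        rw [hB1]; exact ⟨z, hz, _, rfl, h⟩
    intro v w hvw
    rcases marg_cases v with rfl | ⟨i, b, rfl⟩ <;> rcases marg_cases w with rfl | ⟨j, c, rfl⟩
    · exact absurd rfl hvw.ne
    · exact hc j c
    · obtain ⟨p, hp, q, hq, h⟩ := hc i b
      exact ⟨q, hq, p, hp, h.symm⟩
    · obtain ⟨rfl, hbc⟩ := marg_adj_petal.1 hvw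
      obtain ⟨y, hy, h⟩ := hxy i
      cases b <;> cases c
      · exact absurd rfl hbc
      · rw [hB1, hB2]; exact ⟨y, hy, _, rfl, h.symm⟩
      · rw [hB1, hB2]; exact ⟨_, rfl, y, hy, h⟩
      · exact absurd rfl hbc

theorem cycles_adj {n : ℕ} (hn : 2 ≤ n) {u v : Fin n} : (SimpleGraph.cycleGraph n).Adj u v ↔
    u.val + 1 = v.val ∨ v.val + 1 = u.val ∨ (u.val = 0 ∧ v.val + 1 = n) ∨
      (v.val = 0 ∧ u.val + 1 = n) := by
  have key : ∀ a b : Fin n, (a - b).val = 1 ↔ b.val + 1 = a.val ∨ (a.val = 0 ∧ b.val + 1 = n) := by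
    intro a b
    have ha := a.2
    have hb := b.2
    rw [Fin.sub_def]
    change (n - b.val + a.val) % n = 1 ↔ _
    by_cases hab : b.val ≤ a.val
    · have : n - b.val + a.val = (a.val - b.val) + n := by omega
      rw [this, Nat.add_mod_right, Nat.mod_eq_of_lt (by omega)]
      omega
    · rw [Nat.mod_eq_of_lt (by omega)]
      omega
  rw [SimpleGraph.cycleGraph_adj', key, key]
  omega

theorem isMinor_cycles {G : FinGraph} {n : ℕ} (hn : 2 ≤ n) (B : ℕ → Set G.V)
    (hc : ∀ i < n, (G.graph.induce (B i)).Connected)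
    (hd : ∀ i < n, ∀ j < i, Disjoint (B i) (B j))
    (hs : ∀ i, i + 1 < n → ∃ x ∈ B i, ∃ y ∈ B (i + 1), G.graph.Adj x y)
    (hl : ∃ x ∈ B (n - 1), ∃ y ∈ B 0, G.graph.Adj x y) : IsMinor (cycles n) G := by
  refine ⟨fun v : Fin n => B v.val, fun v : Fin n => hc _ v.2, ?_, ?_⟩
  · intro (v : Fin n) (w : Fin n) hvw
    rcases lt_or_gt_of_ne (Fin.val_ne_of_ne hvw) with h | h
    · exact (hd _ w.2 _ h).symm
    · exact hd _ v.2 _ h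
  · intro (v : Fin n) (w : Fin n) hvw
    have sw : ∀ {A B : Set G.V}, (∃ x ∈ A, ∃ y ∈ B, G.graph.Adj x y) →
        ∃ x ∈ B, ∃ y ∈ A, G.graph.Adj x y := by
      rintro A B ⟨x, hx, y, hy, h⟩
      exact ⟨y, hy, x, hx, h.symm⟩
    change ∃ x ∈ B v.val, ∃ y ∈ B w.val, G.graph.Adj x y
    rcases (cycles_adj hn).1 hvw with h | h | ⟨h, h'⟩ | ⟨h, h'⟩
    · rw [← h]; exact hs _ (h ▸ w.2)
    · rw [← h]; exact sw (hs _ (h ▸ v.2))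
    · rw [h, show w.val = n - 1 by omega]; exact sw hl
    · rw [h, show v.val = n - 1 by omega]; exact hl

theorem isParametric_triangles : IsParametric triangles := fun k =>
  IsMinor.of_injective (H := triangles k) (G := triangles (k + 1))
    (fun v : Fin k × Fin 3 => ((v.1.castSucc, v.2) : Fin (k + 1) × Fin 3))
    (by
      rintro ⟨i, a⟩ ⟨j, b⟩ h
      obtain ⟨h1, h2⟩ := Prod.ext_iff.1 h
      exact Prod.ext (Fin.castSucc_injective k h1) h2)
    (by
      rintro ⟨i, a⟩ ⟨j, b⟩ ⟨h1, h2⟩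
      obtain rfl : i = j := h1
      exact ⟨rfl, h2⟩)

theorem isParametric_marguerite : IsParametric marguerite := fun k => by
  refine isMinor_marguerite (Z := {margCenter (k + 1)}) (connected_induce_singleton _ _)
    (fun i => {v | ∃ b, v = margPetal i.castSucc b}) ?_ ?_ ?_
  · intro i
    refine ⟨connected_induce_of_rank (t := margPetal i.castSucc true) ⟨_, rfl⟩
      (fun v => by classical exact if v = margPetal i.castSucc true then 0 else 1) ?_,
      _, ⟨true, rfl⟩, _, ⟨false, rfl⟩, fun h => by simpa using (margPetal_inj.1 h).2,
      ⟨_, rfl, marg_adj_center _ _⟩, ⟨_, rfl, marg_adj_center _ _⟩⟩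
    rintro v ⟨b, rfl⟩ hne
    refine ⟨_, ⟨true, rfl⟩, marg_adj_petal.2 ⟨rfl, fun h => hne (by rw [h])⟩, ?_⟩
    simp only [if_neg hne, if_true]
    exact Nat.zero_lt_one
  · intro i j hij
    refine Set.disjoint_left.2 ?_
    rintro v ⟨b, rfl⟩ ⟨c, h⟩
    exact hij (Fin.castSucc_injective k (margPetal_inj.1 h).1)
  · intro i
    refine Set.disjoint_left.2 ?_
    rintro v rfl ⟨c, h⟩
    exact margPetal_ne_center _ _ h.symm

theorem isParametric_cycles : IsParametric cycles := fun k => by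
  rcases Nat.lt_or_ge k 2 with hk | hk
  · refine IsMinor.of_injective (H := cycles k) (G := cycles (k + 1)) Fin.castSucc
      (Fin.castSucc_injective k) ?_
    intro (u : Fin k) (v : Fin k) h
    have := h.ne
    exact absurd (Fin.ext (by omega)) this
  · have hk' : 2 ≤ k + 1 := by omega
    -- The last two vertices of the longer cycle form one branch set.
    refine isMinor_cycles (G := cycles (k + 1)) hk
      (fun i => {v : Fin (k + 1) | v.val = i ∨ (i + 1 = k ∧ v.val = k)}) ?_ ?_ ?_ ?_
    · intro i hi
      refine connected_induce_of_rank (V := Fin (k + 1)) (t := ⟨i, by omega⟩) (Or.inl rfl)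
        Fin.val ?_
      rintro v (hv | ⟨h1, h2⟩) hne
      · exact absurd (Fin.ext hv) hne
      · refine ⟨⟨i, by omega⟩, Or.inl rfl, (cycles_adj hk').2 (Or.inl ?_), ?_⟩
        · change i + 1 = v.val; omega
        · change i < v.val; omega
    · intro i hi j hj
      refine Set.disjoint_left.2 ?_
      rintro v hv hv'
      have hv : v.val = i ∨ (i + 1 = k ∧ v.val = k) := hv
      have hv' : v.val = j ∨ (j + 1 = k ∧ v.val = k) := hv'
      omega
    · intro i hi
      exact ⟨(⟨i, by omega⟩ : Fin (k + 1)), Or.inl rfl, (⟨i + 1, by omega⟩ : Fin (k + 1)),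
        Or.inl rfl, (cycles_adj hk').2 (Or.inl rfl)⟩
    · exact ⟨(⟨k, by omega⟩ : Fin (k + 1)), Or.inr ⟨by omega, rfl⟩, (⟨0, by omega⟩ : Fin (k + 1)),
        Or.inl rfl, (cycles_adj hk').2 (Or.inr (Or.inr (Or.inr ⟨rfl, rfl⟩)))⟩

/-! ### Lower bounds -/

theorem reachable_of_triangle {V : Type} {G : SimpleGraph V} {u v w : V} (huv : G.Adj u v)
    (huw : G.Adj u w) (hwv : G.Adj w v) : (G.deleteEdges {s(u, v)}).Reachable u v := by
  refine SimpleGraph.Reachable.trans (v := w) (SimpleGraph.Adj.reachable ?_)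
    (SimpleGraph.Adj.reachable ?_) <;> rw [SimpleGraph.deleteEdges_adj]
  · refine ⟨huw, fun h => ?_⟩
    simp only [Set.mem_singleton_iff, Sym2.eq_iff] at h
    rcases h with ⟨-, h⟩ | ⟨h, -⟩
    · exact hwv.ne h
    · exact huv.ne h
  · refine ⟨hwv, fun h => ?_⟩
    simp only [Set.mem_singleton_iff, Sym2.eq_iff] at h
    rcases h with ⟨h, -⟩ | ⟨-, h⟩
    · exact huw.ne h.symm
    · exact huv.ne h.symm

theorem le_idf_triangles (t : ℕ) : 2 * t ≤ idf (triangles t) := by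
  obtain ⟨X, hX, hcov⟩ := exists_cover_of_idf (triangles t)
  refine le_trans ?_ hX
  have h1 : ∀ v ∈ Xᶜ, ∀ w ∈ Xᶜ, v.1 = w.1 → v = w := by
    rintro ⟨i, a⟩ hv ⟨j, b⟩ hw hij
    obtain rfl : i = j := hij
    by_contra hne
    have hab : a ≠ b := fun h => hne (by rw [h])
    obtain ⟨c, hac, hcb⟩ : ∃ c : Fin 3, a ≠ c ∧ c ≠ b := by
      clear hv hw hne
      revert a b
      decide
    rcases hcov (i, a) (i, b) ⟨rfl, hab⟩
      (reachable_of_triangle (w := (i, c)) ⟨rfl, hab⟩ ⟨rfl, hac⟩ ⟨rfl, hcb⟩) with h | h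
    · exact hv h
    · exact hw h
  have h2 : Xᶜ.ncard ≤ t := by
    have := Set.ncard_le_ncard_of_injOn (s := Xᶜ) (t := (Set.univ : Set (Fin t))) Prod.fst
      (fun _ _ => trivial) (fun v hv w hw h => h1 v hv w hw h) (Set.toFinite _)
    simpa [Set.ncard_univ] using this
  have h3 := Set.ncard_add_ncard_compl X
  have h4 : Nat.card (triangles t).V = t * 3 := by
    change Nat.card (Fin t × Fin 3) = _
    simp
  omega

theorem lt_idf_marguerite {k : ℕ} (hk : 1 ≤ k) : k < idf (marguerite k) := by
  obtain ⟨X, hX, hcov⟩ := exists_cover_of_idf (marguerite k)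
  refine lt_of_lt_of_le ?_ hX
  have hpet : ∀ i, ∃ b, margPetal i b ∈ X := by
    intro i
    rcases hcov (margPetal i true) (margPetal i false) (marg_adj_petal.2 ⟨rfl, by simp⟩)
      (reachable_of_triangle (w := margCenter k) (marg_adj_petal.2 ⟨rfl, by simp⟩)
        (marg_adj_center _ _).symm (marg_adj_center _ _)) with h | h
    · exact ⟨_, h⟩
    · exact ⟨_, h⟩
  choose b hb using hpet
  let g : Fin k → (marguerite k).V := fun i => margPetal i (b i)
  have hg : Function.Injective g := fun i j h => (margPetal_inj.1 h).1
  have hcard : (Set.range g).ncard = k := by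
    rw [← Set.image_univ, Set.ncard_image_of_injective _ hg, Set.ncard_univ]
    simp
  have hex : ∃ x ∈ X, x ∉ Set.range g := by
    by_cases hc : margCenter k ∈ X
    · exact ⟨_, hc, by rintro ⟨i, hi⟩; exact margPetal_ne_center _ _ hi⟩
    · refine ⟨margPetal ⟨0, hk⟩ (!(b ⟨0, hk⟩)), ?_, ?_⟩
      · refine (hcov (margCenter k) _ (marg_adj_center _ _)
          (reachable_of_triangle (w := margPetal ⟨0, hk⟩ (b ⟨0, hk⟩)) (marg_adj_center _ _)
            (marg_adj_center _ _) (marg_adj_petal.2 ⟨rfl, by simp⟩))).resolve_left hc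
      · rintro ⟨i, hi⟩
        obtain ⟨rfl, h⟩ := margPetal_inj.1 hi
        simp at h
  obtain ⟨x, hx, hxg⟩ := hex
  refine lt_of_eq_of_lt hcard.symm ?_
  refine Set.ncard_lt_ncard ⟨?_, fun h => hxg (h hx)⟩ (Set.toFinite _)
  rintro _ ⟨i, rfl⟩
  exact hb i

theorem le_idf_cycles {n : ℕ} (hn : 3 ≤ n) : n ≤ 2 * idf (cycles n) := by
  obtain ⟨X, hX, hcov⟩ := exists_cover_of_idf (cycles n)
  have hn2 : 2 ≤ n := by omega
  let σ : Fin n → Fin n := fun i => ⟨if i.val + 1 < n then i.val + 1 else 0, by split <;> omega⟩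
  have hσ : ∀ i : Fin n, i ∈ X ∨ σ i ∈ X := by
    intro i
    have hadj : (SimpleGraph.cycleGraph n).Adj i (σ i) := by
      rw [cycles_adj hn2]
      have := i.2
      change i.val + 1 = (if i.val + 1 < n then i.val + 1 else 0) ∨ _ ∨ _ ∨
        ((if i.val + 1 < n then i.val + 1 else 0) = 0 ∧ _)
      split <;> omega
    refine hcov i (σ i) hadj ?_
    -- The walk from `σ i` around the cycle to `i`.
    let p : ℕ → Fin n := fun j => if h : i.val + 1 + j < n then ⟨i.val + 1 + j, h⟩ else
      ⟨(i.val + 1 + j - n) % n, Nat.mod_lt _ (by omega)⟩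
    have hi := i.2
    have hp : ∀ j < n, (p j).val = if i.val + 1 + j < n then i.val + 1 + j
        else i.val + 1 + j - n := by
      intro j hj
      by_cases h : i.val + 1 + j < n
      · simp [p, h]
      · simp only [p, dif_neg h, if_neg h]
        exact Nat.mod_eq_of_lt (by omega)
    have hr : ∀ j < n, ((SimpleGraph.cycleGraph n).deleteEdges {s(i, σ i)}).Reachable (p 0) (p j) := by
      intro j
      induction j with
      | zero => exact fun _ => .rfl
      | succ j ih =>
        intro hj
        refine (ih (by omega)).trans (SimpleGraph.Adj.reachable ?_)
        have h1 := hp j (by omega)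
        have h2 := hp (j + 1) hj
        rw [SimpleGraph.deleteEdges_adj]
        refine ⟨(cycles_adj hn2).2 ?_, ?_⟩
        · split_ifs at h1 h2 <;> omega
        · intro h
          simp only [Set.mem_singleton_iff, Sym2.eq_iff, Fin.ext_iff, σ] at h
          split_ifs at h1 h2 h <;> omega
    have h0 : p 0 = σ i := by
      have := hp 0 (by omega)
      refine Fin.ext ?_
      change _ = if i.val + 1 < n then i.val + 1 else 0
      split_ifs at this ⊢ <;> omega
    have hlast : p (n - 1) = i := by
      have := hp (n - 1) (by omega)
      refine Fin.ext ?_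
      split_ifs at this <;> omega
    have := hr (n - 1) (by omega)
    rw [h0, hlast] at this
    exact this.symm
  have hinj : Function.Injective σ := by
    intro i j h
    have := Fin.ext_iff.1 h
    refine Fin.ext ?_
    have hi := i.2
    have hj := j.2
    simp only [σ] at this
    split_ifs at this <;> omega
  have h1 : (Set.univ : Set (Fin n)) ⊆ X ∪ σ ⁻¹' X := fun i _ => hσ i
  have h2 := Set.ncard_le_ncard h1 (Set.toFinite _)
  have h3 := Set.ncard_union_le X (σ ⁻¹' X)
  have h4 : (σ ⁻¹' X).ncard ≤ X.ncard :=
    Set.ncard_le_ncard_of_injOn σ (fun _ h => h) hinj.injOn (Set.toFinite _)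
  have h5 : (Set.univ : Set (Fin n)).ncard = n := by simp [Set.ncard_univ]
  have h3 : (X ∪ σ ⁻¹' X).ncard ≤ X.ncard + (σ ⁻¹' X).ncard := h3
  omega

/-! ### Minor-minimality -/

/-- A minor of `G` that is not isomorphic to `G` has a model that does without some edge `uv` of
`G` to realise its edges; the edge `uv` may still be needed to connect a branch set. -/
theorem IsMinor.exists_unused_edge {H G : FinGraph} (h : IsMinor H G)
    (hiso : ¬ Nonempty (H.graph ≃g G.graph)) (hG : ∀ v, ∃ w, G.graph.Adj v w) :
    ∃ B : H.V → Set G.V, (∀ v, (G.graph.induce (B v)).Connected) ∧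
      (∀ v w x, x ∈ B v → x ∈ B w → v = w) ∧
      ∃ u v, G.graph.Adj u v ∧ ∀ a b, H.graph.Adj a b →
        ∃ x ∈ B a, ∃ y ∈ B b, G.graph.Adj x y ∧ s(x, y) ≠ s(u, v) := by
  obtain ⟨B, hBc, hBd, hB⟩ := h
  have huniq : ∀ v w x, x ∈ B v → x ∈ B w → v = w := by
    intro v w x hv hw
    by_contra hne
    exact Set.disjoint_left.1 (hBd v w hne) hv hw
  refine ⟨B, hBc, huniq, ?_⟩
  by_cases hcov : ∀ v, ∃ h, v ∈ B h
  swap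
  · push Not at hcov
    obtain ⟨v, hv⟩ := hcov
    obtain ⟨w, hvw⟩ := hG v
    refine ⟨v, w, hvw, fun a b hab => ?_⟩
    obtain ⟨x, hx, y, hy, hxy⟩ := hB a b hab
    refine ⟨x, hx, y, hy, hxy, fun he => ?_⟩
    rcases Sym2.eq_iff.1 he with ⟨rfl, -⟩ | ⟨-, rfl⟩
    · exact hv _ hx
    · exact hv _ hy
  by_cases hsing : ∀ h, ∀ x ∈ B h, ∀ y ∈ B h, x = y
  swap
  · push Not at hsing
    obtain ⟨h, x, hx, y, hy, hxy⟩ := hsing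
    obtain ⟨p, hp, q, hq, hpq⟩ := (connected_induce_iff_cut.1 (hBc h)).2 {x}
      (Set.singleton_subset_iff.2 hx) ⟨x, rfl⟩ ⟨y, hy, fun h => hxy h.symm⟩
    obtain rfl : p = x := hp
    refine ⟨p, q, hpq, fun a b hab => ?_⟩
    obtain ⟨x', hx', y', hy', hxy'⟩ := hB a b hab
    refine ⟨x', hx', y', hy', hxy', fun he => hab.ne ?_⟩
    rcases Sym2.eq_iff.1 he with ⟨rfl, rfl⟩ | ⟨rfl, rfl⟩
    · rw [huniq _ _ _ hx' hx, huniq _ _ _ hy' hq.1]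
    · rw [huniq _ _ _ hx' hq.1, huniq _ _ _ hy' hx]
  choose g hg using fun h => (connected_induce_iff_cut.1 (hBc h)).1
  have hgeq : ∀ h, ∀ x ∈ B h, x = g h := fun h x hx => hsing h x hx _ (hg h)
  have hbij : Function.Bijective g := by
    refine ⟨fun a b hab => huniq _ _ _ (hg a) (hab ▸ hg b), fun v => ?_⟩
    obtain ⟨h, hv⟩ := hcov v
    exact ⟨h, (hgeq h v hv).symm⟩
  have hadj : ∀ a b, H.graph.Adj a b → G.graph.Adj (g a) (g b) := by
    intro a b hab
    obtain ⟨x, hx, y, hy, hxy⟩ := hB a b hab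
    rwa [← hgeq a x hx, ← hgeq b y hy]
  by_cases hfull : ∀ a b, G.graph.Adj (g a) (g b) → H.graph.Adj a b
  · exact absurd ⟨⟨Equiv.ofBijective g hbij, fun {a b} => ⟨hfull a b, hadj a b⟩⟩⟩ hiso
  push Not at hfull
  obtain ⟨a, b, hab, hnab⟩ := hfull
  refine ⟨g a, g b, hab, fun a' b' hab' => ⟨g a', hg a', g b', hg b', hadj _ _ hab', fun he => ?_⟩⟩
  rcases Sym2.eq_iff.1 he with ⟨h1, h2⟩ | ⟨h1, h2⟩
  · exact hnab (hbij.1 h1 ▸ hbij.1 h2 ▸ hab')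
  · exact hnab (hbij.1 h1 ▸ hbij.1 h2 ▸ hab').symm

/-- The number of branch sets that meet `X` is at most the number of vertices of `X`. -/
theorem ncard_meeting_le {U V : Type} [Finite U] [Finite V] {B : U → Set V}
    (hB : ∀ v w x, x ∈ B v → x ∈ B w → v = w) (X : Set V) :
    {h | (B h ∩ X).Nonempty}.ncard ≤ X.ncard := by
  rcases isEmpty_or_nonempty V with hV | ⟨⟨v₀⟩⟩
  · have : {h | (B h ∩ X).Nonempty} = ∅ := by
      rw [Set.eq_empty_iff_forall_notMem]
      rintro h ⟨x, -⟩
      exact hV.elim x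
    rw [this, Set.ncard_empty]
    exact Nat.zero_le _
  have : ∀ h, ∃ x, (B h ∩ X).Nonempty → x ∈ B h ∩ X := by
    intro h
    by_cases hh : (B h ∩ X).Nonempty
    · exact ⟨hh.some, fun _ => hh.some_mem⟩
    · exact ⟨v₀, fun h => absurd h hh⟩
  choose g hg using this
  refine Set.ncard_le_ncard_of_injOn g (fun h hh => (hg h hh).2) ?_ (Set.toFinite _)
  intro a ha b hb hab
  exact hB a b _ (hg a ha).1 (hab ▸ (hg b hb).1)

theorem isObstruction_cycles {k : ℕ} (hk : 1 ≤ k) :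
    IsObstruction (forestsId k) (cycles (2 * k + 1)) := by
  have hn2 : 2 ≤ 2 * k + 1 := by omega
  have hlow := le_idf_cycles (n := 2 * k + 1) (by omega)
  refine ⟨fun h => ?_, fun H hH hnot => ?_⟩
  · have : idf (cycles (2 * k + 1)) ≤ k := h
    omega
  by_contra hiso
  obtain ⟨B, hBc, huniq, (u : Fin (2 * k + 1)), (v : Fin (2 * k + 1)), huv, hB⟩ :=
    hH.exists_unused_edge hiso (by
      intro (v : Fin (2 * k + 1))
      refine ⟨(⟨if v.val + 1 < 2 * k + 1 then v.val + 1 else 0, by split <;> omega⟩ :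
        Fin (2 * k + 1)), (cycles_adj hn2).2 ?_⟩
      have := v.2
      change v.val + 1 = (if v.val + 1 < 2 * k + 1 then v.val + 1 else 0) ∨ _ ∨ _ ∨
        ((if v.val + 1 < 2 * k + 1 then v.val + 1 else 0) = 0 ∧ _)
      split <;> omega)
  -- The edge is oriented so that `v` is the successor of `u`.
  wlog hdir : u.val + 1 = v.val ∨ (v.val = 0 ∧ u.val + 1 = 2 * k + 1) generalizing u v
  · refine this v u (SimpleGraph.Adj.symm huv) ?_ ?_
    · simpa only [Sym2.eq_swap (a := v)] using hB
    · have := (cycles_adj hn2).1 huv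
      omega
  refine hnot (idf_le_iff.2 ?_)
  -- Every second vertex of the cycle, starting from the second one after `u`.
  let o : Fin (2 * k + 1) → ℕ := fun a =>
    if u.val ≤ a.val then a.val - u.val else a.val + (2 * k + 1) - u.val
  let X : Set (Fin (2 * k + 1)) := {a | o a % 2 = 0 ∧ a ≠ u}
  have hX : X.ncard ≤ k := by
    have : X.ncard ≤ (Set.univ : Set (Fin k)).ncard := by
      have hlt : ∀ a : Fin (2 * k + 1), (o a - 1) / 2 < k := by
        intro a
        have h1 := a.2
        have h2 := u.2
        simp only [o]
        split <;> omega
      refine Set.ncard_le_ncard_of_injOn (fun a => (⟨(o a - 1) / 2, hlt a⟩ : Fin k))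
        (fun _ _ => trivial) ?_ (Set.toFinite _)
      rintro a ⟨ha, hau⟩ b ⟨hb, hbu⟩ hab
      have hab := Fin.ext_iff.1 hab
      have hau := Fin.val_ne_of_ne hau
      have hbu := Fin.val_ne_of_ne hbu
      have h1 := a.2
      have h2 := b.2
      refine Fin.ext ?_
      simp only [o] at ha hb hab
      split_ifs at ha hb hab <;> omega
    simpa [Set.ncard_univ] using this
  refine idfOn_of_cover (X := {h | (B h ∩ X).Nonempty}) ?_
    (Or.inl ((ncard_meeting_le huniq X).trans hX))
  intro a _ b _ hab
  obtain ⟨(x : Fin (2 * k + 1)), hx, (y : Fin (2 * k + 1)), hy, hxy, hne⟩ := hB a b hab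
  have hcov : x ∈ X ∨ y ∈ X := by
    have hxy := (cycles_adj hn2).1 hxy
    have hne : ¬ ((x = u ∧ y = v) ∨ (x = v ∧ y = u)) := fun h => hne (Sym2.eq_iff.2 h)
    simp only [X, Set.mem_ofPred_eq, o, Fin.ext_iff, ne_eq] at hne ⊢
    have h1 := x.2
    have h2 := y.2
    have h3 := u.2
    have h4 := v.2
    split_ifs <;> omega
  rcases hcov with h | h
  · exact Or.inl ⟨x, hx, h⟩
  · exact Or.inr ⟨y, hy, h⟩

theorem isObstruction_triangles (k : ℕ) :
    IsObstruction (forestsId k) (triangles (k / 2 + 1)) := by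
  have hlow := le_idf_triangles (k / 2 + 1)
  refine ⟨fun h => ?_, fun H hH hnot => ?_⟩
  · have : idf (triangles (k / 2 + 1)) ≤ k := h
    omega
  by_contra hiso
  obtain ⟨B, hBc, huniq, ⟨i, p⟩, ⟨j, q⟩, huv, hB⟩ :=
    hH.exists_unused_edge hiso (by
      rintro ⟨i, a⟩
      obtain ⟨b, hb⟩ : ∃ b : Fin 3, a ≠ b := by revert a; decide
      exact ⟨(i, b), rfl, hb⟩)
  obtain rfl : i = j := huv.1
  have hpq : p ≠ q := huv.2
  obtain ⟨w, hw⟩ : ∃ w : Fin 3, ∀ x y : Fin 3, x ≠ y →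
      ¬ ((x = p ∧ y = q) ∨ (x = q ∧ y = p)) → x = w ∨ y = w := by
    clear huv hB
    revert p q
    decide
  refine hnot (idf_le_iff.2 ?_)
  have hconst : ∀ h, ∀ x ∈ B h, ∀ y ∈ B h, x.1 = y.1 := by
    intro h x hx y hy
    by_contra hne
    obtain ⟨a, ha, b, hb, hab⟩ := (connected_induce_iff_cut.1 (hBc h)).2 {z | z ∈ B h ∧ z.1 = x.1}
      (fun z hz => hz.1) ⟨x, hx, rfl⟩ ⟨y, hy, fun h => hne h.2.symm⟩
    exact hb.2 ⟨hb.1, hab.1.symm.trans ha.2⟩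
  -- Two vertices of each triangle other than the `i`-th one.
  let X : Set (Fin (k / 2 + 1) × Fin 3) := {i}ᶜ ×ˢ {2}ᶜ
  have hX : X.ncard ≤ k := by
    have h1 := Set.ncard_add_ncard_compl ({i} : Set (Fin (k / 2 + 1)))
    have h2 := Set.ncard_add_ncard_compl ({2} : Set (Fin 3))
    simp only [Set.ncard_singleton, Nat.card_eq_fintype_card, Fintype.card_fin] at h1 h2
    have h3 : X.ncard = ({i}ᶜ : Set (Fin (k / 2 + 1))).ncard * ({2}ᶜ : Set (Fin 3)).ncard :=
      Set.ncard_prod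
    have h4 : ({i}ᶜ : Set (Fin (k / 2 + 1))).ncard = k / 2 := by omega
    have h5 : ({2}ᶜ : Set (Fin 3)).ncard = 2 := by omega
    rw [h3, h4, h5]
    omega
  let A : Set H.V := {h | ∃ x ∈ B h, x.1 = i}
  have hcov : ∀ a b, H.graph.Adj a b → (a ∈ A ∧ b ∈ A) ∨ (B a ∩ X).Nonempty ∨
      (B b ∩ X).Nonempty := by
    intro a b hab
    obtain ⟨x, hx, y, hy, hxy, -⟩ := hB a b hab
    by_cases hxi : x.1 = i
    · exact Or.inl ⟨⟨x, hx, hxi⟩, ⟨y, hy, hxy.1 ▸ hxi⟩⟩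
    · by_cases hx2 : x.2 = 2
      · exact Or.inr (Or.inr ⟨y, hy, fun h => hxi (hxy.1.trans h), fun h => hxy.2 (hx2.trans h.symm)⟩)
      · exact Or.inr (Or.inl ⟨x, hx, hxi, hx2⟩)
  have hXm := (ncard_meeting_le huniq X).trans hX
  by_cases hAne : A.Nonempty
  swap
  · refine idfOn_of_cover (X := {h | (B h ∩ X).Nonempty}) ?_ (Or.inl hXm)
    intro a _ b _ hab
    exact (hcov a b hab).resolve_left fun h => hAne ⟨a, h.1⟩
  obtain ⟨c, hc⟩ := hAne
  have hA : IdfOn H.graph A 0 := by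
    refine idfOn_of_cover (X := {h | (B h ∩ {(i, w)}).Nonempty}) ?_
      (Or.inr ((ncard_meeting_le huniq _).trans (Set.ncard_singleton _).le))
    rintro a ⟨x', hx', rfl⟩ b - hab
    obtain ⟨⟨x1, x2⟩, hx, ⟨y1, y2⟩, hy, ⟨h1, h2⟩, hne⟩ := hB a b hab
    obtain rfl : x1 = y1 := h1
    obtain rfl : x'.1 = x1 := hconst a x' hx' _ hx
    have hne' : ¬ ((x2 = p ∧ y2 = q) ∨ (x2 = q ∧ y2 = p)) := by
      rintro (⟨rfl, rfl⟩ | ⟨rfl, rfl⟩)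
      · exact hne rfl
      · exact hne Sym2.eq_swap
    rcases hw x2 y2 h2 hne' with rfl | rfl
    · exact Or.inl ⟨_, hx, rfl⟩
    · exact Or.inr ⟨_, hy, rfl⟩
  have hA' : IdfOn H.graph (Aᶜ ∪ {c}) k := by
    refine idfOn_of_cover (X := {h | (B h ∩ X).Nonempty}) ?_ (Or.inl hXm)
    intro a ha b hb hab
    refine (hcov a b hab).resolve_left ?_
    rintro ⟨haA, hbA⟩
    have h1 : a = c := ha.resolve_left fun h => h haA
    have h2 : b = c := hb.resolve_left fun h => h hbA
    exact hab.ne (h1.trans h2.symm)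
  have := idfOn_union (c := c) hA hA' hc (Or.inr rfl) ?_ ?_
  · rw [← Set.union_assoc, Set.union_compl_self, Set.univ_union, Nat.zero_add] at this
    exact this
  · rintro v hv (h | h)
    · exact absurd hv h
    · exact h
  · rintro a ⟨x', hx', rfl⟩ b (hb | hb) hab
    · obtain ⟨x, hx, y, hy, hxy, -⟩ := hB a b hab
      exact absurd ⟨y, hy, hxy.1.symm.trans (hconst a x hx x' hx')⟩ hb
    · exact Or.inr hb

/-- A minor of a marguerite that does without the edge `e` maps to a forest: a vertex cover `X`
with one vertex for each triangle covers all the edges but the outer edge of the `i`-th triangle,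
where `e` lies in the `i`-th triangle. If that edge is not `e`, one of its ends is not joined to
the centre, and hangs off the other end. -/
theorem isObstruction_marguerite {k m : ℕ} (hk : 1 ≤ k) (hm : m ≤ k) (hkm : k ≤ m ∨ k ≤ 1) :
    IsObstruction (forestsId m) (marguerite k) := by
  have hlow := lt_idf_marguerite hk
  refine ⟨fun h => ?_, fun H hH hnot => ?_⟩
  · have : idf (marguerite k) ≤ m := h
    omega
  by_contra hiso
  obtain ⟨B, hBc, huniq, u, v, huv, hB⟩ :=
    hH.exists_unused_edge hiso (by
      intro v
      rcases marg_cases v with rfl | ⟨i, b, rfl⟩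
      · exact ⟨_, marg_adj_center ⟨0, hk⟩ true⟩
      · exact ⟨_, (marg_adj_center i b).symm⟩)
  have hedge : ∃ i : Fin k, s(u, v) = s(margPetal i true, margPetal i false) ∨
      ∃ b, s(u, v) = s(margCenter k, margPetal i b) := by
    rcases marg_cases u with rfl | ⟨i, b, rfl⟩ <;> rcases marg_cases v with rfl | ⟨j, c, rfl⟩
    · exact absurd rfl huv.ne
    · exact ⟨j, Or.inr ⟨c, rfl⟩⟩
    · exact ⟨i, Or.inr ⟨b, Sym2.eq_swap⟩⟩
    · obtain ⟨rfl, hbc⟩ := marg_adj_petal.1 huv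
      refine ⟨i, Or.inl ?_⟩
      cases b <;> cases c
      · exact absurd rfl hbc
      · exact Sym2.eq_swap
      · rfl
      · exact absurd rfl hbc
  clear huv
  obtain ⟨i, he⟩ := hedge
  refine hnot (idf_le_iff.2 ?_)
  classical
  let X : Set (marguerite k).V :=
    Set.range fun j : Fin k => if j = i then margCenter k else margPetal j true
  have hX : X.ncard ≤ k := by
    have h1 : X.ncard ≤ (Set.univ : Set (Fin k)).ncard := by
      rw [show X = (fun j : Fin k => if j = i then margCenter k else margPetal j true) '' Set.univ
        from Set.image_univ.symm]
      exact Set.ncard_image_le (Set.toFinite _)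
    simpa [Set.ncard_univ] using h1
  have hcX : margCenter k ∈ X := ⟨i, if_pos rfl⟩
  have hcovG : ∀ x y, (marguerite k).graph.Adj x y → x ∈ X ∨ y ∈ X ∨
      s(x, y) = s(margPetal i true, margPetal i false) := by
    intro x y hxy
    rcases marg_cases x with rfl | ⟨j, b, rfl⟩
    · exact Or.inl hcX
    rcases marg_cases y with rfl | ⟨j', c, rfl⟩
    · exact Or.inr (Or.inl hcX)
    obtain ⟨rfl, hbc⟩ := marg_adj_petal.1 hxy
    by_cases hji : j = i
    · subst hji
      refine Or.inr (Or.inr ?_)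
      cases b <;> cases c
      · exact absurd rfl hbc
      · exact Sym2.eq_swap
      · rfl
      · exact absurd rfl hbc
    · cases b
      · cases c
        · exact absurd rfl hbc
        · exact Or.inr (Or.inl ⟨j, if_neg hji⟩)
      · exact Or.inl ⟨j, if_neg hji⟩
  let Y : Set H.V := {h | (B h ∩ X).Nonempty}
  have hY : ∀ S : Set H.V, (∀ a ∈ S, ∀ b ∈ S, H.graph.Adj a b → a ∈ Y ∨ b ∈ Y) →
      IdfOn H.graph S m := fun S hS => by
    have hYk := (ncard_meeting_le huniq X).trans hX
    exact idfOn_of_cover hS (hkm.imp hYk.trans hYk.trans)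
  rcases he with he | ⟨b, he⟩
  · refine hY _ fun a _ a' _ hab => ?_
    obtain ⟨x, hx, y, hy, hxy, hne⟩ := hB a a' hab
    rcases hcovG x y hxy with h | h | h
    · exact Or.inl ⟨x, hx, h⟩
    · exact Or.inr ⟨y, hy, h⟩
    · exact absurd (h.trans he.symm) hne
  have hpp : s(margPetal i true, margPetal i false) = s(margPetal i b, margPetal i (!b)) := by
    cases b
    · exact Sym2.eq_swap
    · rfl
  rw [hpp] at hcovG
  -- An edge of `H` that `Y` does not cover joins the branch sets of the two ends of the outer edge.
  have hleft : ∀ a a', H.graph.Adj a a' → (a ∈ Y ∨ a' ∈ Y) ∨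
      (margPetal i b ∈ B a ∧ margPetal i (!b) ∈ B a') ∨
      (margPetal i b ∈ B a' ∧ margPetal i (!b) ∈ B a) := by
    intro a a' hab
    obtain ⟨x, hx, y, hy, hxy, hne⟩ := hB a a' hab
    rcases hcovG x y hxy with h | h | h
    · exact Or.inl (Or.inl ⟨x, hx, h⟩)
    · exact Or.inl (Or.inr ⟨y, hy, h⟩)
    · rcases Sym2.eq_iff.1 h with ⟨rfl, rfl⟩ | ⟨rfl, rfl⟩
      · exact Or.inr (Or.inl ⟨hx, hy⟩)
      · exact Or.inr (Or.inr ⟨hy, hx⟩)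
  by_cases hall : ∀ a a', H.graph.Adj a a' → a ∈ Y ∨ a' ∈ Y
  · exact hY _ fun a _ a' _ => hall a a'
  push Not at hall
  obtain ⟨h, h', hadj, hhY, hhY'⟩ : ∃ h h', H.graph.Adj h h' ∧ h ∉ Y ∧
      (margPetal i b ∈ B h ∧ margPetal i (!b) ∈ B h') := by
    obtain ⟨a, a', hab, ha, ha'⟩ := hall
    rcases hleft a a' hab with (h | h) | h | h
    · exact absurd h ha
    · exact absurd h ha'
    · exact ⟨a, a', hab, ha, h⟩
    · exact ⟨a', a, hab.symm, ha', h⟩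
  obtain ⟨hp, hp'⟩ := hhY'
  have hBh : ∀ x ∈ B h, x = margPetal i b := by
    intro x hx
    by_contra hne
    obtain ⟨_, rfl, q, ⟨hq, hqn⟩, hadjq⟩ := (connected_induce_iff_cut.1 (hBc h)).2 {margPetal i b}
      (Set.singleton_subset_iff.2 hp) ⟨_, rfl⟩ ⟨x, hx, hne⟩
    rcases marg_cases q with rfl | ⟨j, c, rfl⟩
    · exact hhY ⟨_, hq, hcX⟩
    · obtain ⟨rfl, hbc⟩ := marg_adj_petal.1 hadjq
      have : c = !b := by cases b <;> cases c <;> simp_all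
      subst this
      exact hadj.ne (huniq _ _ _ hq hp')
  have hnbr : ∀ a, H.graph.Adj h a → a = h' := by
    intro a ha
    obtain ⟨x, hx, y, hy, hxy, hne⟩ := hB h a ha
    obtain rfl := hBh x hx
    rcases marg_cases y with rfl | ⟨j, c, rfl⟩
    · exact absurd (Sym2.eq_swap.trans he.symm) hne
    · obtain ⟨rfl, hbc⟩ := marg_adj_petal.1 hxy
      have : c = !b := by cases b <;> cases c <;> simp_all
      subst this
      exact huniq _ _ _ hy hp'
  have h1 : IdfOn H.graph {h, h'} 0 := by
    refine idfOn_of_cover (X := {h}) ?_ (Or.inr (Set.ncard_singleton _).le)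
    rintro a (rfl | rfl) a' (rfl | rfl) hab
    · exact Or.inl rfl
    · exact Or.inl rfl
    · exact Or.inr rfl
    · exact absurd rfl hab.ne
  have h2 : IdfOn H.graph {h}ᶜ m := by
    refine hY _ fun a ha a' ha' hab => ?_
    rcases hleft a a' hab with h | h | h
    · exact h
    · exact absurd (huniq _ _ _ h.1 hp) ha
    · exact absurd (huniq _ _ _ h.1 hp) ha'
  have := idfOn_union (c := h') h1 h2 (Or.inr rfl) hadj.ne.symm ?_ ?_
  · rw [Nat.zero_add] at this
    refine (?_ : ({h, h'} : Set H.V) ∪ {h}ᶜ = Set.univ) ▸ this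
    rw [Set.eq_univ_iff_forall]
    intro x
    by_cases hx : x = h
    · exact Or.inl (Or.inl hx)
    · exact Or.inr hx
  · rintro a (rfl | rfl) ha
    · exact absurd rfl ha
    · rfl
  · rintro a (rfl | rfl) a' - hab
    · exact Or.inr (hnbr a' hab)
    · exact Or.inl rfl

/-! ### Non-comparability -/

/-- Let `l` label the vertices of `G` such that the ends of each edge outside `Z` have the same
label and each label occurs at most `n` times outside `Z`. Then no path on more than `n` vertices
of a minor of `G` has all its branch sets outside `Z`. -/
theorem not_path_of_labels {H G : FinGraph} {B : H.V → Set G.V} {Z : Set G.V} {ι : Type}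
    (l : G.V → ι) {n : ℕ} (hBc : ∀ v, (G.graph.induce (B v)).Connected)
    (hBd : ∀ v w, v ≠ w → Disjoint (B v) (B w))
    (hB : ∀ v w, H.graph.Adj v w → ∃ x ∈ B v, ∃ y ∈ B w, G.graph.Adj x y)
    (hl : ∀ x y, x ∉ Z → y ∉ Z → G.graph.Adj x y → l x = l y)
    (hn : ∀ a, {x | x ∉ Z ∧ l x = a}.ncard ≤ n) (g : Fin (n + 1) → H.V)
    (hg : Function.Injective g) (hpath : ∀ i : Fin n, H.graph.Adj (g i.castSucc) (g i.succ))
    (hZ : ∀ i, Disjoint (B (g i)) Z) : False := by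
  have hconst : ∀ i, ∀ x ∈ B (g i), ∀ y ∈ B (g i), l x = l y := by
    intro i x hx y hy
    by_contra hne
    obtain ⟨a, ha, b, hb, hab⟩ := (connected_induce_iff_cut.1 (hBc (g i))).2
      {z | z ∈ B (g i) ∧ l z = l x} (fun z hz => hz.1) ⟨x, hx, rfl⟩ ⟨y, hy, fun h => hne h.2.symm⟩
    refine hb.2 ⟨hb.1, (hl a b ?_ ?_ hab).symm.trans ha.2⟩
    · exact Set.disjoint_left.1 (hZ i) ha.1
    · exact Set.disjoint_left.1 (hZ i) hb.1
  choose x hx using fun i => (connected_induce_iff_cut.1 (hBc (g i))).1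
  have hall : ∀ i, l (x i) = l (x 0) := by
    intro i
    induction i using Fin.induction with
    | zero => rfl
    | succ i ih =>
      obtain ⟨p, hp, q, hq, hpq⟩ := hB _ _ (hpath i)
      rw [← ih, hconst _ _ (hx i.succ) q hq, hconst _ _ (hx i.castSucc) p hp]
      exact (hl p q (Set.disjoint_left.1 (hZ _) hp) (Set.disjoint_left.1 (hZ _) hq) hpq).symm
  have hcard : (Set.univ : Set (Fin (n + 1))).ncard ≤ {y | y ∉ Z ∧ l y = l (x 0)}.ncard := by
    refine Set.ncard_le_ncard_of_injOn x ?_ ?_ (Set.toFinite _)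
    · exact fun i _ => ⟨Set.disjoint_left.1 (hZ i) (hx i), hall i⟩
    · intro i _ j _ hij
      by_contra hne
      exact Set.disjoint_left.1 (hBd _ _ fun h => hne (hg h)) (hx i) (hij ▸ hx j)
  have h1 : (Set.univ : Set (Fin (n + 1))).ncard = n + 1 := by simp [Set.ncard_univ]
  have h2 := hn (l (x 0))
  omega

theorem not_isMinor_triangles_of_path {H : FinGraph} (g : Fin 4 → H.V) (hg : Function.Injective g)
    (hpath : ∀ i : Fin 3, H.graph.Adj (g i.castSucc) (g i.succ)) (m : ℕ) :
    ¬ IsMinor H (triangles m) := by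
  rintro ⟨B, hBc, hBd, hB⟩
  refine not_path_of_labels (Z := ∅) (n := 3) Prod.fst hBc hBd hB (fun x y _ _ h => h.1) ?_ g hg
    hpath (fun i => Set.disjoint_empty _)
  intro a
  have : ({x : Fin m × Fin 3 | x ∉ (∅ : Set (Fin m × Fin 3)) ∧ x.1 = a}).ncard ≤
      (Set.univ : Set (Fin 3)).ncard := by
    refine Set.ncard_le_ncard_of_injOn Prod.snd (fun _ _ => trivial) ?_ (Set.toFinite _)
    rintro x ⟨-, hx⟩ y ⟨-, hy⟩ h
    exact Prod.ext (hx.trans hy.symm) h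
  simpa [Set.ncard_univ] using this

/-- If every vertex of `H` is avoided by some path on three vertices, then `H` is not a minor of a
marguerite: without its centre, a marguerite has no connected set of three vertices. -/
theorem not_isMinor_marguerite_of_paths {H : FinGraph}
    (hH : ∀ h : H.V, ∃ g : Fin 3 → H.V, Function.Injective g ∧
      (∀ i : Fin 2, H.graph.Adj (g i.castSucc) (g i.succ)) ∧ ∀ i, g i ≠ h) (h₀ : H.V) (m : ℕ) :
    ¬ IsMinor H (marguerite m) := by
  rintro ⟨B, hBc, hBd, hB⟩
  obtain ⟨h, hh⟩ : ∃ h, ∀ h', h' ≠ h → margCenter m ∉ B h' := by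
    by_cases hc : ∃ h, margCenter m ∈ B h
    · obtain ⟨h, hh⟩ := hc
      exact ⟨h, fun h' hne hh' => Set.disjoint_left.1 (hBd _ _ hne) hh' hh⟩
    · exact ⟨h₀, fun h' _ hh' => hc ⟨h', hh'⟩⟩
  obtain ⟨g, hg, hpath, hgh⟩ := hH h
  let l : (marguerite m).V → Option (Fin m) := Sum.elim (fun v => some v.1.1) (fun _ => none)
  have hl : ∀ i b, l (margPetal i b) = some i := fun i b => rfl
  refine not_path_of_labels (Z := {margCenter m}) (n := 2) l hBc hBd hB ?_ ?_ g hg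
    hpath (fun i => Set.disjoint_singleton_right.2 (hh _ (hgh i)))
  · intro x y hx hy hxy
    rcases marg_cases x with rfl | ⟨i, b, rfl⟩
    · exact absurd rfl hx
    rcases marg_cases y with rfl | ⟨j, c, rfl⟩
    · exact absurd rfl hy
    rw [hl, hl, (marg_adj_petal.1 hxy).1]
  · intro a
    rcases a with _ | i
    · refine le_of_eq_of_le ?_ (Nat.zero_le 2)
      rw [Set.ncard_eq_zero, Set.eq_empty_iff_forall_notMem]
      rintro x ⟨hx, hxa⟩
      rcases marg_cases x with rfl | ⟨i, b, rfl⟩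
      · exact hx rfl
      · simp [hl] at hxa
    · refine (Set.ncard_le_ncard (t := {margPetal i true, margPetal i false}) ?_
        (Set.toFinite _)).trans ((Set.ncard_insert_le _ _).trans
          (by rw [Set.ncard_singleton]))
      rintro x ⟨hx, hxa⟩
      rcases marg_cases x with rfl | ⟨j, b, rfl⟩
      · exact absurd rfl hx
      · rw [hl] at hxa
        obtain rfl := Option.some_injective _ hxa
        cases b
        · exact Or.inr rfl
        · exact Or.inl rfl

/-- A cycle becomes a forest when any of its vertices is deleted, so that every triangle of a minor
of a cycle contains every vertex of the minor. -/
theorem not_isMinor_cycles_of_triangle {H : FinGraph} {h a b c : H.V} (hab : H.graph.Adj a b)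
    (hac : H.graph.Adj a c) (hbc : H.graph.Adj b c) (ha : a ≠ h) (hb : b ≠ h) (hc : c ≠ h)
    (m : ℕ) : ¬ IsMinor H (cycles m) := by
  rintro ⟨B, hBc, hBd, hB⟩
  obtain ⟨(x : Fin m), hx⟩ := (connected_induce_iff_cut.1 (hBc h)).1
  -- The cycle without `x` is ranked by the distance from `x` in the positive direction.
  let F : SimpleGraph (Fin m) :=
    { Adj := fun u v => u ≠ x ∧ v ≠ x ∧ (SimpleGraph.cycleGraph m).Adj u v
      symm := ⟨fun _ _ h => ⟨h.2.1, h.1, h.2.2.symm⟩⟩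
      loopless := ⟨fun _ h => h.2.2.ne rfl⟩ }
  have hF : F.IsAcyclic := by
    refine isAcyclic_of_rank (fun v => if x.val ≤ v.val then v.val - x.val
      else v.val + m - x.val) ?_
    rintro v u w ⟨hv, hu, hvu⟩ ⟨-, hw, hvw⟩ h1 h2
    have hm : 2 ≤ m := by
      have := v.2
      have := u.2
      have := Fin.val_ne_of_ne hvu.ne
      omega
    have hvu := (cycles_adj hm).1 hvu
    have hvw := (cycles_adj hm).1 hvw
    have := v.2
    have := u.2
    have := w.2
    have := x.2
    have hv := Fin.val_ne_of_ne hv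
    have hu := Fin.val_ne_of_ne hu
    have hw := Fin.val_ne_of_ne hw
    refine Fin.ext ?_
    split_ifs at h1 h2 <;> omega
  let Q : Fin 3 → H.V := ![a, b, c]
  have hQinj : ∀ i j, i ≠ j → Q i ≠ Q j := by
    intro i j hij
    fin_cases i <;> fin_cases j <;>
      first | exact absurd rfl hij | exact hab.ne | exact hac.ne | exact hbc.ne |
        exact hab.ne.symm | exact hac.ne.symm | exact hbc.ne.symm
  have hQadj : ∀ i j, i ≠ j → H.graph.Adj (Q i) (Q j) := by
    intro i j hij
    fin_cases i <;> fin_cases j <;>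
      first | exact absurd rfl hij | exact hab | exact hac | exact hbc |
        exact hab.symm | exact hac.symm | exact hbc.symm
  have hQx : ∀ i, ∀ y ∈ B (Q i), y ≠ x := by
    rintro i y hy rfl
    have : Q i ≠ h := by fin_cases i <;> assumption
    exact Set.disjoint_left.1 (hBd _ _ this) hy hx
  have hFadj : ∀ i j, i ≠ j → (bagGraph F fun i => B (Q i)).Adj i j := by
    intro i j hij
    obtain ⟨p, hp, q, hq, hpq⟩ := hB _ _ (hQadj i j hij)
    exact ⟨hij, p, hp, q, hq, hQx _ p hp, hQx _ q hq, hpq⟩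
  have hac := isAcyclic_bagGraph hF (fun i => B (Q i)) ?_ (fun i j hij => hBd _ _ (hQinj i j hij))
  · refine not_reachable_of_isAcyclic (x := 0) (y := 1) hac ?_
      (reachable_of_triangle (w := 2) ?_ ?_ ?_)
    all_goals
      refine hFadj _ _ ?_
      decide
  · intro i
    rw [connected_induce_iff_cut]
    obtain ⟨h1, h2⟩ := connected_induce_iff_cut.1 (hBc (Q i))
    refine ⟨h1, fun T hT hne hne' => ?_⟩
    obtain ⟨p, hp, q, hq, hpq⟩ := h2 T hT hne hne'
    exact ⟨p, hp, q, hq, hQx i p (hT hp), hQx i q hq.1, hpq⟩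

theorem pairwise_not_comparable :
    ({triangles, cycles, marguerite} : Set (ℕ → FinGraph)).Pairwise
      fun A B => ¬ Comparable A B := by
  have hTC : ∀ m, ¬ IsMinor (triangles 2) (cycles m) := by
    refine not_isMinor_cycles_of_triangle (H := triangles 2) (h := ((0 : Fin 2), (0 : Fin 3)))
      (a := ((1 : Fin 2), (0 : Fin 3))) (b := ((1 : Fin 2), (1 : Fin 3)))
      (c := ((1 : Fin 2), (2 : Fin 3))) ⟨rfl, ?_⟩ ⟨rfl, ?_⟩ ⟨rfl, ?_⟩ ?_ ?_ ?_ <;> decide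
  have hMC : ∀ m, ¬ IsMinor (marguerite 2) (cycles m) :=
    not_isMinor_cycles_of_triangle (h := margPetal 0 true) (a := margCenter 2)
      (b := margPetal 1 true) (c := margPetal 1 false) (marg_adj_center _ _) (marg_adj_center _ _)
      (marg_adj_petal.2 ⟨rfl, by decide⟩) (margPetal_ne_center _ _).symm
      (fun h => by simpa using (margPetal_inj.1 h).1) (fun h => by simpa using (margPetal_inj.1 h).1)
  have hCT : ∀ m, ¬ IsMinor (cycles 4) (triangles m) := by
    refine not_isMinor_triangles_of_path (H := cycles 4) (id : Fin 4 → Fin 4)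
      Function.injective_id ?_
    intro i
    exact (cycles_adj (by decide)).2 (Or.inl rfl)
  have hMT : ∀ m, ¬ IsMinor (marguerite 2) (triangles m) := by
    refine not_isMinor_triangles_of_path (H := marguerite 2)
      ![margPetal 0 true, margCenter 2, margPetal 1 true, margPetal 1 false] ?_ ?_
    · intro i j hij
      fin_cases i <;> fin_cases j <;>
        simp [margPetal_inj, margPetal_ne_center, (margPetal_ne_center _ _).symm] at hij ⊢
    · intro i
      fin_cases i
      · exact (marg_adj_center _ _).symm
      · exact marg_adj_center _ _
      · exact marg_adj_petal.2 ⟨rfl, by decide⟩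
  have hTM : ∀ m, ¬ IsMinor (triangles 2) (marguerite m) := by
    refine not_isMinor_marguerite_of_paths (H := triangles 2) ?_ ((0 : Fin 2), (0 : Fin 3))
    rintro ⟨i, a⟩
    refine ⟨fun j => (((1 : Fin 2) - i), j), fun j j' h => (Prod.ext_iff.1 h).2, ?_, ?_⟩
    · intro j
      refine ⟨rfl, ?_⟩
      change j.castSucc ≠ j.succ
      revert j; decide
    · intro j h
      have : (1 : Fin 2) - i = i := (Prod.ext_iff.1 h).1
      clear h
      revert i
      decide
  have hCM : ∀ m, ¬ IsMinor (cycles 4) (marguerite m) := by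
    refine not_isMinor_marguerite_of_paths (H := cycles 4) ?_ (0 : Fin 4)
    intro (h : Fin 4)
    refine ⟨(fun i : Fin 3 => h + i.succ : Fin 3 → Fin 4), ?_, ?_, ?_⟩
    · intro i j hij
      exact Fin.succ_injective _ (add_left_cancel hij)
    · intro i
      refine (cycles_adj (by decide)).2 ?_
      revert h i
      decide
    · intro i
      change h + i.succ ≠ h
      revert h i
      decide
  rintro A (rfl | rfl | rfl) B (rfl | rfl | rfl) hne (h | h)
  all_goals first
    | exact hne rfl
    | exact (h 2).elim hTC
    | exact (h 2).elim hMC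
    | exact (h 2).elim hMT
    | exact (h 2).elim hTM
    | exact (h 4).elim hCT
    | exact (h 4).elim hCM

/-! ### Depth-first search trees -/

/-- `l` describes a depth-first search tree of `G[S]` with root `r`: `l v` lists the path of the
tree from `v` to the root. The parent of `v` is a neighbour of `v`, and of any two adjacent
vertices one is an ancestor of the other. So `u` is an ancestor of `v` if and only if `l u` is a
suffix of `l v`, and the length of `l v` is the depth of `v`, the root having depth `1`. -/
structure IsDFSTree {V : Type} (G : SimpleGraph V) (S : Set V) (r : V) (l : V → List V) :
    Prop where
  root : l r = [r]
  root_mem : r ∈ S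
  parent : ∀ v ∈ S, v ≠ r → ∃ u ∈ S, G.Adj u v ∧ l v = v :: l u
  adj : ∀ u ∈ S, ∀ v ∈ S, G.Adj u v → l u <:+ l v ∨ l v <:+ l u

/-- Let `K` be a component of `S` without the root `r`. A tree of `K` rooted at a neighbour of `r`
is attached below `r` to a tree of `S \ K`. -/
theorem exists_isDFSTree {V : Type} [Finite V] {G : SimpleGraph V} {S : Set V} {r : V}
    (hS : (G.induce S).Connected) (hr : r ∈ S) : ∃ l, IsDFSTree G S r l := by
  classical
  induction hn : S.ncard using Nat.strong_induction_on generalizing S r with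
  | _ n ih =>
  subst hn
  by_cases hsing : S = {r}
  · subst hsing
    refine ⟨fun v => [v], rfl, rfl, fun v hv hne => absurd hv hne, ?_⟩
    rintro u hu v hv -
    rw [show u = r from hu, show v = r from hv]
    exact Or.inl (List.suffix_refl _)
  have hne : (S \ {r}).Nonempty := by
    by_contra hno
    rw [Set.not_nonempty_iff_eq_empty, Set.sdiff_eq_empty] at hno
    exact hsing (Set.Subset.antisymm hno (Set.singleton_subset_iff.2 hr))
  obtain ⟨x, hx, r', hr', hrr'⟩ := (connected_induce_iff_cut.1 hS).2 {r}
    (Set.singleton_subset_iff.2 hr) ⟨r, rfl⟩ hne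
  rw [Set.mem_singleton_iff.1 hx] at hrr'
  obtain ⟨K, hKS, hr'K, hK, hcl⟩ := exists_component G hr'
  have hrK : r ∉ K := fun h => (hKS h).2 rfl
  have hKS' : K ⊆ S := fun v hv => (hKS hv).1
  have hcl' : ∀ u ∈ K, ∀ v ∈ S, G.Adj u v → v ≠ r → v ∈ K :=
    fun u hu v hv huv hvr => hcl u hu v ⟨hv, hvr⟩ huv
  have hL : (G.induce (S \ K)).Connected := by
    rw [connected_induce_iff_cut]
    refine ⟨⟨r, hr, hrK⟩, ?_⟩
    -- It suffices to leave the side of the cut that avoids the root.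
    have key : ∀ T ⊆ S \ K, T.Nonempty → r ∉ T → ∃ x ∈ T, ∃ y ∈ (S \ K) \ T, G.Adj x y := by
      intro T hT hTne hrT
      obtain ⟨x, hx, y, ⟨hyS, hyT⟩, hxy⟩ := (connected_induce_iff_cut.1 hS).2 T
        (fun v hv => (hT hv).1) hTne ⟨r, hr, hrT⟩
      refine ⟨x, hx, y, ⟨⟨hyS, fun hyK => (hT hx).2 ?_⟩, hyT⟩, hxy⟩
      exact hcl' y hyK x (hT hx).1 hxy.symm fun h => hrT (h ▸ hx)
    intro T hT hTne hTne'
    by_cases hrT : r ∈ T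
    · obtain ⟨x, hx, y, hy, hxy⟩ := key ((S \ K) \ T) Set.sdiff_subset hTne' fun h => h.2 hrT
      refine ⟨y, ?_, x, hx, hxy.symm⟩
      by_contra hyT
      exact hy.2 ⟨hy.1, hyT⟩
    · exact key T hT hTne hrT
  obtain ⟨l₁, h₁⟩ := ih K.ncard (Set.ncard_lt_ncard ⟨hKS', fun h => hrK (h hr)⟩ (Set.toFinite _))
    hK hr'K rfl
  obtain ⟨l₂, h₂⟩ := ih (S \ K).ncard
    (Set.ncard_lt_ncard ⟨Set.sdiff_subset, fun h => (h hr'.1).2 hr'K⟩ (Set.toFinite _))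
    hL ⟨hr, hrK⟩ rfl
  let l : V → List V := fun v => if v ∈ K then l₁ v ++ [r] else l₂ v
  have e₁ : ∀ v ∈ K, l v = l₁ v ++ [r] := fun v hv => if_pos hv
  have e₂ : ∀ v ∉ K, l v = l₂ v := fun v hv => if_neg hv
  refine ⟨l, (e₂ r hrK).trans h₂.root, hr, ?_, ?_⟩
  · intro v hv hvr
    by_cases hvK : v ∈ K
    · by_cases hvr' : v = r'
      · subst hvr'
        exact ⟨r, hr, hrr', by rw [e₁ _ hvK, h₁.root, e₂ r hrK, h₂.root]; rfl⟩
      · obtain ⟨u, hu, huv, hl⟩ := h₁.parent v hvK hvr'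
        exact ⟨u, hKS' hu, huv, by rw [e₁ v hvK, e₁ u hu, hl]; rfl⟩
    · obtain ⟨u, hu, huv, hl⟩ := h₂.parent v ⟨hv, hvK⟩ hvr
      exact ⟨u, hu.1, huv, by rw [e₂ v hvK, e₂ u hu.2, hl]⟩
  · have hmix : ∀ u ∈ K, ∀ v ∈ S, v ∉ K → G.Adj u v → l v <:+ l u := by
      intro u hu v hv hvK huv
      have hvr : v = r := by
        by_contra hvr
        exact hvK (hcl' u hu v hv huv hvr)
      rw [hvr, e₂ r hrK, h₂.root, e₁ u hu]
      exact List.suffix_append _ _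
    have happ : ∀ {a b : List V}, a <:+ b → a ++ [r] <:+ b ++ [r] := by
      rintro a b ⟨t, rfl⟩
      exact ⟨t, by simp⟩
    intro u hu v hv huv
    by_cases huK : u ∈ K <;> by_cases hvK : v ∈ K
    · rw [e₁ u huK, e₁ v hvK]
      exact (h₁.adj u huK v hvK huv).imp happ happ
    · exact Or.inr (hmix u huK v hv hvK huv)
    · exact Or.inl (hmix v hvK u hu huK huv.symm)
    · rw [e₂ u huK, e₂ v hvK]
      exact h₂.adj u ⟨hu, huK⟩ v ⟨hv, hvK⟩ huv

namespace IsDFSTree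

variable {V : Type} {G : SimpleGraph V} {S : Set V} {r : V} {l : V → List V}

theorem exists_tail (h : IsDFSTree G S r l) {v : V} (hv : v ∈ S) : ∃ t, l v = v :: t := by
  by_cases hvr : v = r
  · exact ⟨[], by rw [hvr, h.root]⟩
  · obtain ⟨u, -, -, hl⟩ := h.parent v hv hvr
    exact ⟨_, hl⟩

theorem eq_of_eq (h : IsDFSTree G S r l) {u v : V} (hu : u ∈ S) (hv : v ∈ S)
    (huv : l u = l v) : u = v := by
  obtain ⟨t, ht⟩ := h.exists_tail hu
  obtain ⟨t', ht'⟩ := h.exists_tail hv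
  rw [ht, ht'] at huv
  exact (List.cons.inj huv).1

theorem depth_pos (h : IsDFSTree G S r l) {v : V} (hv : v ∈ S) : 1 ≤ (l v).length := by
  obtain ⟨t, ht⟩ := h.exists_tail hv
  simp [ht]

theorem eq_of_depth_le (h : IsDFSTree G S r l) {u v : V} (hu : u ∈ S) (hv : v ∈ S)
    (huv : l u <:+ l v) (hd : (l v).length ≤ (l u).length) : u = v :=
  h.eq_of_eq hu hv (huv.eq_of_length (le_antisymm huv.length_le hd))

theorem depth_lt (h : IsDFSTree G S r l) {u v : V} (hu : u ∈ S) (hv : v ∈ S)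
    (huv : l u <:+ l v) (hne : u ≠ v) : (l u).length < (l v).length := by
  by_contra hd
  exact hne (h.eq_of_depth_le hu hv huv (not_lt.1 hd))

/-- Two ancestors of `w` of the same depth are equal. -/
theorem eq_of_depth_eq (h : IsDFSTree G S r l) {u v w : V} (hu : u ∈ S) (hv : v ∈ S)
    (huw : l u <:+ l w) (hvw : l v <:+ l w) (hd : (l u).length = (l v).length) : u = v :=
  h.eq_of_depth_le hu hv (List.suffix_of_suffix_length_le huw hvw hd.le) hd.ge

/-- The parent of `v` lies between `v` and each proper ancestor `u` of `v`. -/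
theorem exists_parent (h : IsDFSTree G S r l) {u v : V} (hu : u ∈ S) (hv : v ∈ S)
    (huv : l u <:+ l v) (hne : u ≠ v) : ∃ p ∈ S, G.Adj p v ∧ l v = v :: l p ∧ l u <:+ l p := by
  have hvr : v ≠ r := by
    rintro rfl
    have := h.depth_lt hu hv huv hne
    have := h.depth_pos hu
    simp only [h.root, List.length_singleton] at *
    omega
  obtain ⟨p, hp, hpv, hl⟩ := h.parent v hv hvr
  refine ⟨p, hp, hpv, hl, ?_⟩
  rw [hl, List.suffix_cons_iff] at huv
  rcases huv with huv | huv
  · exact absurd (h.eq_of_eq hu hv (huv.trans hl.symm)) hne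
  · exact huv

theorem root_suffix (h : IsDFSTree G S r l) {v : V} (hv : v ∈ S) : l r <:+ l v := by
  induction hn : (l v).length using Nat.strong_induction_on generalizing v with
  | _ n ih =>
  by_cases hvr : v = r
  · rw [hvr]
  · obtain ⟨u, hu, -, hl⟩ := h.parent v hv hvr
    have := ih _ (by rw [← hn, hl]; simp) hu rfl
    rw [hl]
    exact this.trans (List.suffix_cons _ _)

/-- The path of the tree between `v` and its ancestor `u` has a vertex of each depth `j` between
the depths of `u` and `v`. -/
theorem exists_depth_eq (h : IsDFSTree G S r l) {u v : V} (hu : u ∈ S) (hv : v ∈ S)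
    (huv : l u <:+ l v) {j : ℕ} (h1 : (l u).length ≤ j) (h2 : j ≤ (l v).length) :
    ∃ w ∈ S, l u <:+ l w ∧ l w <:+ l v ∧ (l w).length = j := by
  induction hn : (l v).length using Nat.strong_induction_on generalizing v with
  | _ n ih =>
  by_cases hj : j = (l v).length
  · exact ⟨v, hv, huv, List.suffix_refl _, hj.symm⟩
  · have hne : u ≠ v := by rintro rfl; omega
    obtain ⟨p, hp, -, hl, hup⟩ := h.exists_parent hu hv huv hne
    have hlen : (l v).length = (l p).length + 1 := by rw [hl]; simp
    obtain ⟨w, hw, h3, h4, h5⟩ := ih (l p).length (by omega) hp hup (by omega) rfl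
    exact ⟨w, hw, h3, h4.trans (hl ▸ List.suffix_cons _ _), h5⟩

theorem connected_subtree (h : IsDFSTree G S r l) {v : V} (hv : v ∈ S) :
    (G.induce {x | x ∈ S ∧ l v <:+ l x}).Connected := by
  refine connected_induce_of_rank (t := v) ⟨hv, List.suffix_refl _⟩ (fun x => (l x).length) ?_
  rintro x ⟨hx, hvx⟩ hne
  obtain ⟨p, hp, hpx, hl, hvp⟩ := h.exists_parent hv hx hvx hne.symm
  exact ⟨p, ⟨hp, hvp⟩, hpx, by rw [hl]; simp⟩

/-- An edge between `y` and its ancestor `x` closes a cycle with the path of the tree between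
them; its length is less than `k` if `G` has no `k`-cycle as a minor. -/
theorem depth_lt_of_adj [Finite V] (h : IsDFSTree G S r l) {k : ℕ} (hk : 3 ≤ k)
    (hC : ¬ IsMinor (cycles k) ⟨V, G⟩) {x y : V} (hx : x ∈ S) (hy : y ∈ S) (hxy : l x <:+ l y)
    (hadj : G.Adj x y) : (l y).length + 1 < (l x).length + k := by
  by_contra hlt
  push Not at hlt
  -- The path is cut into its last `k - 1` vertices and the rest.
  refine hC (isMinor_cycles (G := ⟨V, G⟩) (by omega) (fun i => {u | u ∈ S ∧ l x <:+ l u ∧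
    l u <:+ l y ∧ min ((l y).length - (l u).length) (k - 1) = i}) ?_ ?_ ?_ ?_)
  · intro i hi
    by_cases hik : i = k - 1
    · refine connected_induce_of_rank (t := x) ⟨hx, List.suffix_refl _, hxy, by omega⟩
        (fun u => (l u).length) ?_
      rintro u ⟨hu, hxu, huy, hmin⟩ hne
      obtain ⟨p, hp, hpu, hl, hxp⟩ := h.exists_parent hx hu hxu hne.symm
      have hlen : (l u).length = (l p).length + 1 := by rw [hl]; simp
      exact ⟨p, ⟨hp, hxp, (hl ▸ List.suffix_cons _ _ : l p <:+ l u).trans huy, by omega⟩, hpu,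
        by omega⟩
    · obtain ⟨w, hw, hxw, hwy, hlen⟩ := h.exists_depth_eq hx hy hxy (j := (l y).length - i)
        (by omega) (by omega)
      refine connected_induce_of_rank (t := w) ⟨hw, hxw, hwy, by omega⟩ (fun u => (l u).length) ?_
      rintro u ⟨hu, -, huy, hmin⟩ hne
      have := huy.length_le
      exact absurd (h.eq_of_depth_eq hu hw huy hwy (by omega)) hne
  · intro i hi j hj
    refine Set.disjoint_left.2 ?_
    rintro u ⟨-, -, -, h1⟩ ⟨-, -, -, h2⟩
    omega
  · intro i hi
    obtain ⟨w, hw, hxw, hwy, hlen⟩ := h.exists_depth_eq hx hy hxy (j := (l y).length - i)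
      (by omega) (by omega)
    have hne : x ≠ w := by rintro rfl; omega
    obtain ⟨p, hp, hpw, hl, hxp⟩ := h.exists_parent hx hw hxw hne
    have hlen' : (l w).length = (l p).length + 1 := by rw [hl]; simp
    exact ⟨w, ⟨hw, hxw, hwy, by omega⟩, p,
      ⟨hp, hxp, (hl ▸ List.suffix_cons _ _ : l p <:+ l w).trans hwy, by omega⟩, hpw.symm⟩
  · exact ⟨x, ⟨hx, List.suffix_refl _, hxy, by omega⟩, y, ⟨hy, hxy, List.suffix_refl _, by omega⟩,
      hadj⟩

end IsDFSTree

/-! ### Nonseparable sets -/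

/-- `G[S]` has at least three vertices and is connected even without any one of them. -/
def Nonsep {V : Type} (G : SimpleGraph V) (S : Set V) : Prop :=
  3 ≤ S.ncard ∧ ∀ a ∈ S, (G.induce (S \ {a})).Connected

theorem exists_ne_ne_of_ncard {V : Type} [Finite V] {S : Set V} (h : 3 ≤ S.ncard) (a b : V) :
    ∃ c ∈ S, c ≠ a ∧ c ≠ b := by
  by_contra! hno
  have : S ⊆ {a, b} := by
    intro c hc
    by_cases hca : c = a
    · exact Or.inl hca
    · exact Or.inr (hno c hc hca)
  have h1 := Set.ncard_le_ncard this (Set.toFinite _)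
  have h2 := Set.ncard_insert_le a {b}
  rw [Set.ncard_singleton] at h2
  omega

theorem Nonsep.isPetal {V : Type} [Finite V] {G : SimpleGraph V} {S : Set V} (h : Nonsep G S)
    {a : V} (ha : a ∈ S) : IsPetal G {a} (S \ {a}) := by
  have key : ∀ b ∈ S, b ≠ a → ∃ x ∈ S, x ≠ a ∧ x ≠ b ∧ G.Adj a x := by
    intro b hb hba
    obtain ⟨c, hc, hca, hcb⟩ := exists_ne_ne_of_ncard h.1 a b
    obtain ⟨_, rfl, x, ⟨⟨hx, hxb⟩, hxa⟩, hax⟩ := (connected_induce_iff_cut.1 (h.2 b hb)).2 {a}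
      (Set.singleton_subset_iff.2 ⟨ha, hba.symm⟩) ⟨a, rfl⟩ ⟨c, ⟨hc, hcb⟩, hca⟩
    exact ⟨x, hx, hxa, hxb, hax⟩
  obtain ⟨b, hb, hba, -⟩ := exists_ne_ne_of_ncard h.1 a a
  obtain ⟨x, hx, hxa, -, hax⟩ := key b hb hba
  obtain ⟨y, hy, hya, hyx, hay⟩ := key x hx hxa
  exact ⟨h.2 a ha, x, ⟨hx, hxa⟩, y, ⟨hy, hya⟩, hyx.symm, ⟨a, rfl, hax⟩, ⟨a, rfl, hay⟩⟩

theorem Nonsep.connected {V : Type} [Finite V] {G : SimpleGraph V} {S : Set V}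
    (h : Nonsep G S) : (G.induce S).Connected := by
  obtain ⟨a, ha, -⟩ : ∃ a ∈ S, True := by
    obtain ⟨a, ha⟩ := Set.nonempty_of_ncard_ne_zero (s := S) (by have := h.1; omega)
    exact ⟨a, ha, trivial⟩
  obtain ⟨hc, x, hx, -, -, -, ⟨z, hz, hzx⟩, -⟩ := h.isPetal ha
  have hunion : {a} ∪ (S \ {a}) = S := by
    rw [Set.union_sdiff_self, Set.union_eq_right, Set.singleton_subset_iff]
    exact ha
  rw [← hunion]
  exact SimpleGraph.connected_induce_union (connected_induce_singleton G a).preconnected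
    hc.preconnected hz hx hzx

theorem Nonsep.triangleIn {V : Type} [Finite V] {G : SimpleGraph V} {S : Set V}
    (h : Nonsep G S) : TriangleIn G S := by
  obtain ⟨a, ha⟩ := Set.nonempty_of_ncard_ne_zero (s := S) (by have := h.1; omega)
  exact (h.isPetal ha).triangleIn (connected_induce_singleton G a)
    (Set.disjoint_singleton_left.2 fun h => h.2 rfl) (Set.singleton_subset_iff.2 ha)
    Set.sdiff_subset

theorem exists_fin_of_le_ncard {V : Type} [Finite V] {s : Set V} {k : ℕ} (h : k ≤ s.ncard) :
    ∃ e : Fin k → V, Function.Injective e ∧ ∀ i, e i ∈ s := by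
  have h' : k ≤ Nat.card s := h
  exact ⟨fun i => ((Finite.equivFin s).symm (Fin.castLE h' i)).1,
    fun i j hij => Fin.castLE_injective h' ((Finite.equivFin s).symm.injective (Subtype.ext hij)),
    fun i => ((Finite.equivFin s).symm (Fin.castLE h' i)).2⟩

theorem ncard_le_of_subset_biUnion {V : Type} [Finite V] {s : Set V} {I : Finset ℕ}
    {P : ℕ → Set V} {m : ℕ} (hs : ∀ v ∈ s, ∃ i ∈ I, v ∈ P i) (hP : ∀ i ∈ I, (P i).ncard ≤ m) :
    s.ncard ≤ I.card * m := by
  classical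
  have := Fintype.ofFinite V
  have h1 : s.ncard ≤ ((I.biUnion fun i => (P i).toFinset : Finset V) : Set V).ncard := by
    refine Set.ncard_le_ncard ?_ (Set.toFinite _)
    intro v hv
    obtain ⟨i, hi, hvi⟩ := hs v hv
    simp only [Finset.coe_biUnion, Set.mem_iUnion]
    exact ⟨i, hi, by simpa using hvi⟩
  rw [Set.ncard_coe_finset] at h1
  refine h1.trans (Finset.card_biUnion_le_card_mul _ _ _ fun i hi => ?_)
  rw [← Set.ncard_eq_toFinset_card']
  exact hP i hi

section Nonseparable

variable {V : Type} {G : SimpleGraph V} {S : Set V} {r : V} {l : V → List V}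

/-- In a nonseparable graph, deleting a vertex `v` other than the root does not cut off the
subtree of a child `c` of `v`: some edge joins that subtree to a proper ancestor of `v`. -/
theorem IsDFSTree.exists_back_edge (h : IsDFSTree G S r l) (hS : Nonsep G S) {v c : V}
    (hv : v ∈ S) (hvr : v ≠ r) (hc : c ∈ S) (hl : l c = c :: l v) :
    ∃ x ∈ S, ∃ y ∈ S, G.Adj x y ∧ l c <:+ l y ∧ l x <:+ l v ∧ x ≠ v := by
  have hlen : (l c).length = (l v).length + 1 := by rw [hl]; simp
  have hcv : c ≠ v := by rintro rfl; omega
  have hcr : ¬ l c <:+ l r := by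
    intro hcr
    have h1 := hcr.length_le
    have h2 := h.depth_pos hv
    rw [h.root] at h1
    simp only [List.length_singleton] at h1
    omega
  obtain ⟨y, ⟨⟨hy, hyv⟩, hcy⟩, x, ⟨⟨hx, hxv⟩, hcx⟩, hyx⟩ := (connected_induce_iff_cut.1 (hS.2 v hv)).2
    {y | y ∈ S \ {v} ∧ l c <:+ l y} (fun y hy => hy.1) ⟨c, ⟨hc, hcv⟩, List.suffix_refl _⟩
    ⟨r, ⟨h.root_mem, hvr.symm⟩, fun h => hcr h.2⟩
  have hcx' : ¬ l c <:+ l x := fun h => hcx ⟨⟨hx, hxv⟩, h⟩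
  refine ⟨x, hx, y, hy, hyx.symm, hcy, ?_, hxv⟩
  have hxy : l x <:+ l y := (h.adj x hx y hy hyx.symm).resolve_right fun h => hcx' (hcy.trans h)
  have hxc : l x <:+ l c := (List.suffix_or_suffix_of_suffix hxy hcy).resolve_right hcx'
  rw [hl, List.suffix_cons_iff] at hxc
  rcases hxc with hxc | hxc
  · exact absurd (hl.trans hxc.symm ▸ List.suffix_refl _) hcx'
  · exact hxc

/-- `v` has a descendant exactly `j` levels below it, that is, the subtree of `v` has height at
least `j`. -/
def HasDesc (S : Set V) (l : V → List V) (v : V) (j : ℕ) : Prop :=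
  ∃ u ∈ S, l v <:+ l u ∧ (l u).length = (l v).length + j

theorem IsDFSTree.hasDesc_of_le (h : IsDFSTree G S r l) {u v w : V} {j : ℕ} (hu : u ∈ S)
    (hw : w ∈ S) (huv : l u <:+ l v) (hvw : l v <:+ l w)
    (hj : (l u).length + j ≤ (l w).length) : HasDesc S l u j := by
  obtain ⟨z, hz, h1, -, h3⟩ := h.exists_depth_eq hu hw (huv.trans hvw)
    (j := (l u).length + j) (by omega) hj
  exact ⟨z, hz, h1, h3⟩

/-- The subtrees of the vertices of a given positive height are petals around the connected set of
the vertices of larger height. -/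
theorem IsDFSTree.ncard_height_eq_le [Finite V] (h : IsDFSTree G S r l) (hS : Nonsep G S) {k j : ℕ}
    (hk : 1 ≤ k) (hj : 1 ≤ j) (hM : ¬ IsMinor (marguerite k) ⟨V, G⟩) :
    {v | v ∈ S ∧ HasDesc S l v j ∧ ¬ HasDesc S l v (j + 1)}.ncard ≤ k := by
  by_contra! hlt
  set L : Set V := {v | v ∈ S ∧ HasDesc S l v j ∧ ¬ HasDesc S l v (j + 1)} with hL
  let Z : Set V := {v | v ∈ S ∧ HasDesc S l v (j + 1)}
  have hanc : ∀ u ∈ S, ∀ v ∈ L, l u <:+ l v → u ≠ v → u ∈ Z := by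
    rintro u hu v ⟨hv, ⟨w, hw, hvw, hlen⟩, -⟩ huv hne
    have := h.depth_lt hu hv huv hne
    exact ⟨hu, h.hasDesc_of_le hu hw huv hvw (by omega)⟩
  have hroot : ∀ v ∈ L, v ≠ r := by
    rintro v hv rfl
    have hsub : L ⊆ {v} := by
      intro w hw
      by_contra hne
      exact hv.2.2 (hanc v hv.1 w hw (h.root_suffix hw.1) fun h => hne h.symm).2
    have := Set.ncard_le_ncard hsub (Set.toFinite _)
    rw [Set.ncard_singleton] at this
    omega
  obtain ⟨e, he, heL⟩ := exists_fin_of_le_ncard hlt.le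
  have hZ : (G.induce Z).Connected := by
    have hv := heL ⟨0, hk⟩
    have hrZ : r ∈ Z := hanc r h.root_mem _ hv (h.root_suffix hv.1) (hroot _ hv).symm
    refine connected_induce_of_rank hrZ (fun v => (l v).length) ?_
    rintro v ⟨hv, w, hw, hvw, hlen⟩ hne
    obtain ⟨p, hp, hpv, hl⟩ := h.parent v hv hne
    have hlen' : (l v).length = (l p).length + 1 := by rw [hl]; simp
    exact ⟨p, ⟨hp, h.hasDesc_of_le hp hw (hl ▸ List.suffix_cons _ _) hvw (by omega)⟩, hpv,
      by omega⟩
  refine hM (isMinor_marguerite (G := ⟨V, G⟩) hZ (fun i => {x | x ∈ S ∧ l (e i) <:+ l x}) ?_ ?_ ?_)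
  · intro i
    have hv := heL i
    set v := e i
    obtain ⟨p, hp, hpv, hlp⟩ := h.parent v hv.1 (hroot v hv)
    have hpv' : l p <:+ l v := hlp ▸ List.suffix_cons _ _
    have hpZ : p ∈ Z := hanc p hp v hv hpv' hpv.ne
    obtain ⟨w, hw, hvw, hlen⟩ := hv.2.1
    obtain ⟨c, hc, hvc, -, hclen⟩ := h.exists_depth_eq hv.1 hw hvw (j := (l v).length + 1)
      (by omega) (by omega)
    have hne : v ≠ c := by intro h; rw [← h] at hclen; omega
    obtain ⟨q, hq, -, hlc, hvq⟩ := h.exists_parent hv.1 hc hvc hne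
    have hlc' : (l c).length = (l q).length + 1 := by rw [hlc]; simp
    obtain rfl : v = q := h.eq_of_depth_le hv.1 hq hvq (by omega)
    obtain ⟨x, hx, y, hy, hxy, hcy, hxv, hxne⟩ := h.exists_back_edge hS hv.1 (hroot _ hv) hc hlc
    refine ⟨h.connected_subtree hv.1, v, ⟨hv.1, List.suffix_refl _⟩, y, ⟨hy, hvc.trans hcy⟩, ?_,
      ⟨p, hpZ, hpv⟩, ⟨x, hanc x hx _ hv hxv hxne, hxy⟩⟩
    intro hvy
    have := hcy.length_le
    rw [← hvy] at this
    omega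
  · intro i i' hii
    refine Set.disjoint_left.2 ?_
    rintro x ⟨hx, h1⟩ ⟨-, h2⟩
    rcases List.suffix_or_suffix_of_suffix h1 h2 with h3 | h3
    · exact (heL i).2.2 (hanc _ (heL i).1 _ (heL i') h3 fun h => hii (he h)).2
    · exact (heL i').2.2 (hanc _ (heL i').1 _ (heL i) h3 fun h => hii (he h).symm).2
  · intro i
    refine Set.disjoint_left.2 ?_
    rintro x ⟨hx, w, hw, hxw, hlen⟩ ⟨-, h1⟩
    have := h1.length_le
    exact (heL i).2.2 (h.hasDesc_of_le (heL i).1 hw h1 hxw (by omega))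

/-- Below a vertex `w` whose subtree has height more than `k` there is a triangle model within
`2 * k` levels: a back edge that jumps over the vertex `k` levels below `w`. -/
theorem IsDFSTree.triangleIn_window [Finite V] (h : IsDFSTree G S r l) (hS : Nonsep G S) {k : ℕ}
    (hk : 3 ≤ k) (hC : ¬ IsMinor (cycles k) ⟨V, G⟩) {w : V} (hw : w ∈ S)
    (hwd : HasDesc S l w (k + 1)) :
    TriangleIn G {u | u ∈ S ∧ l w <:+ l u ∧ (l u).length < (l w).length + 2 * k} := by
  obtain ⟨c, hc, hwc, hclen⟩ := hwd
  have hne : w ≠ c := by rintro rfl; omega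
  obtain ⟨v, hv, -, hlc, hwv⟩ := h.exists_parent hw hc hwc hne
  have hlc' : (l c).length = (l v).length + 1 := by rw [hlc]; simp
  have hvr : v ≠ r := by
    rintro rfl
    have := h.depth_pos hw
    have := congrArg List.length h.root
    simp only [List.length_singleton] at this
    omega
  obtain ⟨x, hx, y, hy, hadj, hcy, hxv, hxne⟩ := h.exists_back_edge hS hv hvr hc hlc
  have hvy : l v <:+ l y := (hlc ▸ List.suffix_cons _ _ : l v <:+ l c).trans hcy
  have hxy : l x <:+ l y := hxv.trans hvy
  have hspan := h.depth_lt_of_adj hk hC hx hy hxy hadj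
  have hdc := hcy.length_le
  have hdx := h.depth_lt hx hv hxv hxne
  have hwx : l w <:+ l x := List.suffix_of_suffix_length_le (hwv.trans hvy) hxy (by omega)
  obtain ⟨a, ha, hxa, hay, halen⟩ := h.exists_depth_eq hx hy hxy (j := (l x).length + 1)
    (by omega) (by omega)
  have hxna : x ≠ a := by rintro rfl; omega
  obtain ⟨x', hx', hx'a, hla, hxx'⟩ := h.exists_parent hx ha hxa hxna
  have hla' : (l a).length = (l x').length + 1 := by rw [hla]; simp
  obtain rfl : x = x' := h.eq_of_depth_le hx hx' hxx' (by omega)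
  obtain ⟨q, hq, hqy, hly, hxq⟩ := h.exists_parent hx hy hxy hadj.ne
  have hly' : (l y).length = (l q).length + 1 := by rw [hly]; simp
  let M : Set V := {u | u ∈ S ∧ l x <:+ l u ∧ l u <:+ l y ∧ (l x).length < (l u).length ∧
    (l u).length < (l y).length}
  have haM : a ∈ M := ⟨ha, hxa, hay, by omega, by omega⟩
  have hqM : q ∈ M := ⟨hq, hxq, hly ▸ List.suffix_cons _ _, by omega, by omega⟩
  have hM : (G.induce M).Connected := by
    refine connected_induce_of_rank haM (fun u => (l u).length) ?_
    rintro u ⟨hu, hxu, huy, h1, h2⟩ hne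
    have hxu' : x ≠ u := by rintro rfl; omega
    obtain ⟨p, hp, hpu, hlu, hxp⟩ := h.exists_parent hx hu hxu hxu'
    have hlu' : (l u).length = (l p).length + 1 := by rw [hlu]; simp
    refine ⟨p, ⟨hp, hxp, (hlu ▸ List.suffix_cons _ _ : l p <:+ l u).trans huy, ?_, by omega⟩, hpu,
      by omega⟩
    by_contra hle
    exact hne (h.eq_of_depth_eq hu ha huy hay (by omega))
  refine TriangleIn.of_sets (P := {x}) (Q := {y}) (R := M) ?_ ?_ ?_
    (connected_induce_singleton _ _) (connected_induce_singleton _ _) hM ?_ ?_ ?_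
    ⟨x, rfl, y, rfl, hadj⟩ ⟨x, rfl, a, haM, hx'a⟩ ⟨y, rfl, q, hqM, hqy.symm⟩
  · exact Set.singleton_subset_iff.2 ⟨hx, hwx, by omega⟩
  · exact Set.singleton_subset_iff.2 ⟨hy, hwx.trans hxy, by omega⟩
  · rintro u ⟨hu, hxu, -, -, h2⟩
    exact ⟨hu, hwx.trans hxu, by omega⟩
  · exact Set.disjoint_singleton.2 hadj.ne
  · exact Set.disjoint_singleton_left.2 fun h => lt_irrefl _ h.2.2.2.1
  · exact Set.disjoint_singleton_left.2 fun h => lt_irrefl _ h.2.2.2.2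

theorem IsDFSTree.ncard_residue_le [Finite V] (h : IsDFSTree G S r l) (hS : Nonsep G S) {k : ℕ}
    (hk : 3 ≤ k) (hC : ¬ IsMinor (cycles k) ⟨V, G⟩) (hT : ¬ IsMinor (triangles k) ⟨V, G⟩)
    (ρ : ℕ) :
    {w | w ∈ S ∧ HasDesc S l w (k + 1) ∧ (l w).length % (2 * k) = ρ}.ncard ≤ k := by
  by_contra! hlt
  obtain ⟨e, he, heR⟩ := exists_fin_of_le_ncard hlt.le
  refine hT (isMinor_triangles (G := ⟨V, G⟩) _ ?_ fun i =>
    h.triangleIn_window hS hk hC (heR i).1 (heR i).2.1)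
  have key : ∀ i j, i ≠ j → l (e i) <:+ l (e j) →
      (l (e i)).length + 2 * k ≤ (l (e j)).length := by
    intro i j hij hle
    have h1 := h.depth_lt (heR i).1 (heR j).1 hle fun h => hij (he h)
    have h2 : (l (e i)).length ≡ (l (e j)).length [MOD 2 * k] := (heR i).2.2.trans (heR j).2.2.symm
    have h3 := Nat.le_of_dvd (by omega) ((Nat.modEq_iff_dvd' h1.le).1 h2)
    omega
  intro i j hij
  refine Set.disjoint_left.2 ?_
  rintro u ⟨-, h1, h2⟩ ⟨-, h3, h4⟩
  have h1' := h1.length_le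
  have h3' := h3.length_le
  rcases List.suffix_or_suffix_of_suffix h1 h3 with h5 | h5
  · have := key i j hij h5
    omega
  · have := key j i hij.symm h5
    omega

/-- The vertices of a depth-first search tree that are not leaves form a vertex cover. Those of
height at most `k` are counted by their height, the others by their depth modulo `2 * k`. -/
theorem Nonsep.idfOn [Finite V] (hS : Nonsep G S) {k : ℕ} (hk : 3 ≤ k) (hC : ¬ IsMinor (cycles k) ⟨V, G⟩)
    (hT : ¬ IsMinor (triangles k) ⟨V, G⟩) (hM : ¬ IsMinor (marguerite k) ⟨V, G⟩) :
    IdfOn G S (3 * k ^ 2) := by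
  obtain ⟨r, hr⟩ := Set.nonempty_of_ncard_ne_zero (s := S) (by have := hS.1; omega)
  obtain ⟨l, h⟩ := exists_isDFSTree hS.connected hr
  refine idfOn_of_cover (X := {v | v ∈ S ∧ HasDesc S l v 1}) ?_ (Or.inl ?_)
  · have key : ∀ u ∈ S, ∀ v ∈ S, u ≠ v → l u <:+ l v → HasDesc S l u 1 := by
      intro u hu v hv hne huv
      have := h.depth_lt hu hv huv hne
      exact h.hasDesc_of_le hu hv huv (List.suffix_refl _) (by omega)
    intro u hu v hv huv
    rcases h.adj u hu v hv huv with h1 | h1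
    · exact Or.inl ⟨hu, key u hu v hv huv.ne h1⟩
    · exact Or.inr ⟨hv, key v hv u hu huv.ne.symm h1⟩
  · have h1 := ncard_le_of_subset_biUnion (s := {v | v ∈ S ∧ HasDesc S l v 1 ∧
        ¬ HasDesc S l v (k + 1)}) (I := Finset.Icc 1 k)
      (P := fun j => {v | v ∈ S ∧ HasDesc S l v j ∧ ¬ HasDesc S l v (j + 1)}) (m := k) ?_
      (fun j hj => h.ncard_height_eq_le hS (by omega) (Finset.mem_Icc.1 hj).1 hM)
    have h2 := ncard_le_of_subset_biUnion (s := {v | v ∈ S ∧ HasDesc S l v (k + 1)})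
      (I := Finset.range (2 * k))
      (P := fun ρ => {w | w ∈ S ∧ HasDesc S l w (k + 1) ∧ (l w).length % (2 * k) = ρ}) (m := k) ?_
      (fun ρ _ => h.ncard_residue_le hS hk hC hT ρ)
    · have h3 : {v | v ∈ S ∧ HasDesc S l v 1} ⊆
          {v | v ∈ S ∧ HasDesc S l v 1 ∧ ¬ HasDesc S l v (k + 1)} ∪
            {v | v ∈ S ∧ HasDesc S l v (k + 1)} := by
        rintro v ⟨hv, hv1⟩
        by_cases hvk : HasDesc S l v (k + 1)
        · exact Or.inr ⟨hv, hvk⟩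
        · exact Or.inl ⟨hv, hv1, hvk⟩
      have h4 := (Set.ncard_le_ncard h3 (Set.toFinite _)).trans (Set.ncard_union_le _ _)
      rw [Nat.card_Icc, Nat.add_sub_cancel] at h1
      rw [Finset.card_range] at h2
      nlinarith
    · rintro v ⟨hv, hvk⟩
      exact ⟨_, Finset.mem_range.2 (Nat.mod_lt _ (by omega)), hv, hvk, rfl⟩
    · rintro v ⟨hv, hv1, hvk⟩
      by_contra! hno
      have : ∀ j, j ≤ k → HasDesc S l v (j + 1) := by
        intro j
        induction j with
        | zero => exact fun _ => hv1
        | succ j ih =>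
          intro hj
          by_contra hnd
          exact hno (j + 1) (Finset.mem_Icc.2 ⟨by omega, hj⟩) ⟨hv, ih (by omega), hnd⟩
      exact hvk (this k le_rfl)

end Nonseparable

/-! ### Decomposition into blocks -/

section Blocks

variable {V : Type} [Finite V] {G : SimpleGraph V}

theorem idfOn_zero_of_ncard_le_two {S : Set V} (hS : S.ncard ≤ 2) : IdfOn G S 0 := by
  rcases S.eq_empty_or_nonempty with rfl | ⟨x, hx⟩
  · exact idfOn_of_cover (X := ∅) (fun u hu => absurd hu (Set.notMem_empty u)) (Or.inl (by simp))
  · refine idfOn_of_cover (X := {x}) ?_ (Or.inr (Set.ncard_singleton x).le)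
    intro u hu v hv huv
    by_contra! hno
    have h1 : ({x, u, v} : Set V) ⊆ S := by
      rintro y (rfl | rfl | rfl) <;> assumption
    have h2 : ({x, u, v} : Set V).ncard = 3 :=
      Set.ncard_eq_three.2 ⟨x, u, v, fun h => hno.1 h.symm, fun h => hno.2 h.symm, huv.ne, rfl⟩
    have := Set.ncard_le_ncard h1 (Set.toFinite _)
    omega

/-- `E` is a nonempty part of `S` separated from a nonempty rest of `S` by the vertex `a`. -/
def IsCutPiece (G : SimpleGraph V) (S : Set V) (a : V) (E : Set V) : Prop :=
  a ∈ S ∧ a ∉ E ∧ E ⊆ S ∧ E.Nonempty ∧ ((S \ E) \ {a}).Nonempty ∧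
    ∀ u ∈ E, ∀ v ∈ S, G.Adj u v → v ∈ E ∨ v = a

/-- A set of at least three vertices that is separated by some vertex has a block `insert a E`
that is attached to the rest of the set by the single vertex `a`: choose `E` minimal. -/
theorem exists_leaf_block {S : Set V} (hS : 3 ≤ S.ncard) (hns : ¬ Nonsep G S) :
    ∃ a E, IsCutPiece G S a E ∧ ((insert a E).ncard ≤ 2 ∨ Nonsep G (insert a E)) := by
  -- A large set that is not nonseparable falls into two non-adjacent parts without some vertex.
  have hsep : ∀ B : Set V, 3 ≤ B.ncard → ¬ Nonsep G B → ∃ b ∈ B, ∃ T ⊆ B \ {b}, T.Nonempty ∧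
      ((B \ {b}) \ T).Nonempty ∧ ∀ x ∈ T, ∀ y ∈ (B \ {b}) \ T, ¬ G.Adj x y := by
    intro B hB hnB
    have : ∃ b ∈ B, ¬ (G.induce (B \ {b})).Connected := by
      by_contra! hno
      exact hnB ⟨hB, hno⟩
    obtain ⟨b, hb, hcon⟩ := this
    refine ⟨b, hb, ?_⟩
    by_contra! hno
    obtain ⟨c, hc, hcb, -⟩ := exists_ne_ne_of_ncard hB b b
    exact hcon (connected_induce_iff_cut.2 ⟨⟨c, hc, hcb⟩, hno⟩)
  have hex : ∃ n, ∃ a E, IsCutPiece G S a E ∧ E.ncard = n := by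
    obtain ⟨b, hb, T, hT, hTne, hTne', hadj⟩ := hsep S hS hns
    refine ⟨_, b, T, ⟨hb, fun h => (hT h).2 rfl, fun v hv => (hT hv).1, hTne, ?_, ?_⟩, rfl⟩
    · obtain ⟨y, ⟨hy, hyb⟩, hyT⟩ := hTne'
      exact ⟨y, ⟨hy, hyT⟩, hyb⟩
    · intro u hu v hv huv
      by_contra! hno
      exact hadj u hu v ⟨⟨hv, hno.2⟩, hno.1⟩ huv
  classical
  obtain ⟨a, E, hE, hn⟩ := Nat.find_spec hex
  have hmin : ∀ b E', IsCutPiece G S b E' → ¬ E'.ncard < E.ncard := by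
    intro b E' hE' hlt
    rw [hn] at hlt
    exact Nat.find_min hex hlt ⟨b, E', hE', rfl⟩
  refine ⟨a, E, hE, ?_⟩
  by_contra! hno
  obtain ⟨b, hb, T, hT, hTne, hTne', hadj⟩ := hsep (insert a E) (by omega) hno.2
  obtain ⟨haS, haE, hES, hEne, -, hEadj⟩ := hE
  have hBS : insert a E ⊆ S := Set.insert_subset haS hES
  -- The side of a further separation that avoids `a` is a smaller cut piece.
  have key : ∀ T R : Set V, T ⊆ insert a E \ {b} → R ⊆ insert a E \ {b} → T.Nonempty →
      R.Nonempty → Disjoint T R → insert a E \ {b} ⊆ T ∪ R → (∀ x ∈ T, ∀ y ∈ R, ¬ G.Adj x y) →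
      a ∉ T → False := by
    intro T R hT hR hTne hRne hdis hcov hadj haT
    have hTE : T ⊆ E := fun v hv => (hT hv).1.resolve_left fun h => haT (h ▸ hv)
    obtain ⟨o, ho⟩ := hRne
    have hoT : o ∉ T := fun h => Set.disjoint_left.1 hdis h ho
    refine hmin b T ⟨hBS hb, fun h => (hT h).2 rfl, hTE.trans hES, hTne,
      ⟨o, ⟨hBS (hR ho).1, hoT⟩, (hR ho).2⟩, ?_⟩ (Set.ncard_lt_ncard ⟨hTE, ?_⟩ (Set.toFinite _))
    · intro u hu v hv huv
      by_cases hvb : v = b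
      · exact Or.inr hvb
      · have hvB : v ∈ insert a E := (hEadj u (hTE hu) v hv huv).symm
        exact Or.inl ((hcov ⟨hvB, hvb⟩).resolve_right fun h => hadj u hu v h huv)
    · intro hET
      rcases hb with rfl | hbE
      · exact hoT (hET ((hR ho).1.resolve_left (hR ho).2))
      · exact (hT (hET hbE)).2 rfl
  have hcov : insert a E \ {b} ⊆ T ∪ (insert a E \ {b}) \ T := by
    rw [Set.union_sdiff_self]
    exact Set.subset_union_right
  by_cases haT : a ∈ T
  · refine key ((insert a E \ {b}) \ T) T Set.sdiff_subset hT hTne' hTne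
      Set.disjoint_sdiff_left (by rwa [Set.union_comm]) ?_ fun h => h.2 haT
    exact fun x hx y hy hxy => hadj y hy x hx hxy.symm
  · exact key T ((insert a E \ {b}) \ T) hT Set.sdiff_subset hTne hTne'
      Set.disjoint_sdiff_right hcov hadj haT

/-- If nonseparable sets need at most `M` identified vertices, then `S` needs at most `m * M`,
where `m` is the number of its nonseparable blocks. The blocks `Q 0, …, Q (m - 1)` come in an order
such that the block `Q i` shares at most the vertex `a i` with the previous ones. -/
theorem exists_blocks [Nonempty V] {M : ℕ} (hM : ∀ S, Nonsep G S → IdfOn G S M) (S : Set V) :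
    ∃ (m : ℕ) (Q : ℕ → Set V) (a : ℕ → V), IdfOn G S (m * M) ∧ ∀ i < m, Nonsep G (Q i) ∧
      Q i ⊆ S ∧ a i ∈ Q i ∧ ∀ j < i, ∀ x ∈ Q i, x ∈ Q j → x = a i := by
  induction hn : S.ncard using Nat.strong_induction_on generalizing S with
  | _ n ih =>
  subst hn
  by_cases hS2 : S.ncard ≤ 2
  · exact ⟨0, fun _ => ∅, fun _ => Classical.arbitrary V,
      by simpa using idfOn_zero_of_ncard_le_two hS2, fun i hi => absurd hi (Nat.not_lt_zero i)⟩
  by_cases hns : Nonsep G S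
  · obtain ⟨a, ha⟩ := Set.nonempty_of_ncard_ne_zero (s := S) (by omega)
    refine ⟨1, fun _ => S, fun _ => a, by simpa using hM S hns, fun i hi => ?_⟩
    exact ⟨hns, subset_rfl, ha, fun j hj => by omega⟩
  obtain ⟨a, E, ⟨haS, haE, hES, ⟨e, he⟩, -, hadj⟩, hB⟩ := exists_leaf_block (by omega) hns
  obtain ⟨m, Q, b, hm, hQ⟩ := ih (S \ E).ncard
    (Set.ncard_lt_ncard ⟨Set.sdiff_subset, fun h => (h (hES he)).2 he⟩ (Set.toFinite _)) (S \ E) rfl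
  have hunion : ∀ n, IdfOn G (insert a E) n → IdfOn G S (m * M + n) := by
    intro n hn
    have := idfOn_union (c := a) hm hn ⟨haS, haE⟩ (Set.mem_insert a E) ?_ ?_
    · refine (?_ : S \ E ∪ insert a E = S) ▸ this
      refine Set.Subset.antisymm (Set.union_subset Set.sdiff_subset (Set.insert_subset haS hES)) ?_
      intro v hv
      by_cases hvE : v ∈ E
      · exact Or.inr (Or.inr hvE)
      · exact Or.inl ⟨hv, hvE⟩
    · rintro v ⟨-, hv⟩ (rfl | hvE)
      · rfl
      · exact absurd hvE hv
    · rintro u ⟨hu, huE⟩ v (rfl | hvE) huv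
      · exact Or.inr rfl
      · exact Or.inl ((hadj v hvE u hu huv.symm).resolve_left huE)
  rcases hB with hB | hB
  · refine ⟨m, Q, b, hunion 0 (idfOn_zero_of_ncard_le_two hB), fun i hi => ?_⟩
    obtain ⟨h1, h2, h3⟩ := hQ i hi
    exact ⟨h1, h2.trans Set.sdiff_subset, h3⟩
  · refine ⟨m + 1, fun i => if i < m then Q i else insert a E, fun i => if i < m then b i else a,
      by simpa [Nat.add_mul] using hunion M (hM _ hB), fun i hi => ?_⟩
    by_cases him : i < m
    · obtain ⟨h1, h2, h3, h4⟩ := hQ i him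
      simp only [if_pos him]
      refine ⟨h1, h2.trans Set.sdiff_subset, h3, fun j hj x hx hxj => ?_⟩
      rw [if_pos (hj.trans him)] at hxj
      exact h4 j hj x hx hxj
    · simp only [if_neg him]
      refine ⟨hB, Set.insert_subset haS hES, Set.mem_insert _ _, fun j hj x hx hxj => ?_⟩
      rw [if_pos (by omega)] at hxj
      exact hx.resolve_right ((hQ j (by omega)).2.1 hxj).2

/-- The blocks are coloured with two colours such that a block gets another colour than the
previous block to which it is attached. -/
theorem exists_colouring {W : Type} {m : ℕ} {Q : ℕ → Set W} {a : ℕ → W}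
    (hQ : ∀ i < m, ∀ j < i, ∀ x ∈ Q i, x ∈ Q j → x = a i) :
    ∃ col : ℕ → Bool, ∀ i < m, ∀ j < i, a i ∈ Q j → a i ≠ a j → col i ≠ col j := by
  induction m with
  | zero => exact ⟨fun _ => true, fun i hi => absurd hi (Nat.not_lt_zero i)⟩
  | succ m ih =>
    obtain ⟨col, hcol⟩ := ih fun i hi => hQ i (by omega)
    -- There is at most one previous block that contains `a m` but is not attached at `a m`.
    have hpar : ∃ c : Bool, ∀ j < m, a m ∈ Q j → a m ≠ a j → c ≠ col j := by
      by_cases hex : ∃ j < m, a m ∈ Q j ∧ a m ≠ a j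
      · obtain ⟨j, hj, hjm, hne⟩ := hex
        refine ⟨!(col j), fun j' hj' hjm' hne' => ?_⟩
        have : j' = j := by
          rcases lt_trichotomy j j' with h | h | h
          · exact absurd (hQ j' (by omega) j h _ hjm' hjm) hne'
          · exact h.symm
          · exact absurd (hQ j (by omega) j' h _ hjm hjm') hne
        subst this
        simp
      · push Not at hex
        exact ⟨true, fun j hj h h' => absurd (hex j hj h) h'⟩
    obtain ⟨c, hc⟩ := hpar
    refine ⟨fun i => if i < m then col i else c, fun i hi j hj hij hne => ?_⟩
    by_cases him : i < m
    · simp only [if_pos him, if_pos (hj.trans him)]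
      exact hcol i him j hj hij hne
    · obtain rfl : i = m := by omega
      simp only [if_pos hj, lt_irrefl, if_false]
      exact hc j hj hij hne

/-- Among `2 * k ^ 2` blocks, half have the same colour. Of these, either `k` are attached at the
same vertex, and form a model of a marguerite, or `k` are attached at distinct vertices, and are
disjoint. -/
theorem card_blocks_le {k m : ℕ} {Q : ℕ → Set V} {a : ℕ → V}
    (hQ : ∀ i < m, Nonsep G (Q i) ∧ a i ∈ Q i ∧ ∀ j < i, ∀ x ∈ Q i, x ∈ Q j → x = a i)
    (hT : ¬ IsMinor (triangles k) ⟨V, G⟩) (hM : ¬ IsMinor (marguerite k) ⟨V, G⟩) :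
    m ≤ 2 * k ^ 2 := by
  classical
  obtain ⟨col, hcol⟩ := exists_colouring fun i hi => (hQ i hi).2.2
  have hdis : ∀ i < m, ∀ j < m, i ≠ j → col i = col j → a i ≠ a j → Disjoint (Q i) (Q j) := by
    have key : ∀ i < m, ∀ j < i, col i = col j → a i ≠ a j → Disjoint (Q i) (Q j) := by
      intro i hi j hj hc hne
      refine Set.disjoint_left.2 fun x hx hx' => ?_
      have := (hQ i hi).2.2 j hj x hx hx'
      subst this
      exact hcol i hi j hj hx' hne hc
    intro i hi j hj hij hc hne
    rcases lt_or_gt_of_ne hij with h | h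
    · exact (key j hj i h hc.symm hne.symm).symm
    · exact key i hi j h hc hne
  have hclass : ∀ c, ((Finset.range m).filter fun i => col i = c).card ≤ k ^ 2 := by
    intro c
    set I := (Finset.range m).filter fun i => col i = c with hI
    have hmem : ∀ i ∈ I, i < m ∧ col i = c := by
      intro i hi
      simpa [hI] using hi
    have himage : (I.image a).card ≤ k := by
      by_contra! hlt
      obtain ⟨e, he, heI⟩ := exists_fin_of_le_ncard (s := (↑(I.image a) : Set V)) (k := k)
        (by rw [Set.ncard_coe_finset]; exact hlt.le)
      have : ∀ i, ∃ j ∈ I, a j = e i := fun i => by simpa using heI i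
      choose g hgI hg using this
      refine hT (isMinor_triangles (G := ⟨V, G⟩) (fun i => Q (g i)) ?_ fun i =>
        (hQ _ (hmem _ (hgI i)).1).1.triangleIn)
      intro i j hij
      have hne : a (g i) ≠ a (g j) := by
        rw [hg, hg]
        exact fun h => hij (he h)
      exact hdis _ (hmem _ (hgI i)).1 _ (hmem _ (hgI j)).1 (fun h => hne (by rw [h]))
        ((hmem _ (hgI i)).2.trans (hmem _ (hgI j)).2.symm) hne
    have hfib : ∀ x ∈ I.image a, (I.filter fun i => a i = x).card ≤ k := by
      intro x _
      by_contra! hlt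
      set F := I.filter fun i => a i = x with hF
      have hmemF : ∀ i ∈ F, i < m ∧ a i = x := by
        intro i hi
        rw [hF, Finset.mem_filter] at hi
        exact ⟨(hmem i hi.1).1, hi.2⟩
      let e : Fin k → ℕ := fun i => F.orderEmbOfFin rfl (Fin.castLE hlt.le i)
      have he : Function.Injective e := fun i j hij =>
        Fin.castLE_injective hlt.le ((F.orderEmbOfFin rfl).injective hij)
      have heF : ∀ i, e i ∈ F := fun i => Finset.orderEmbOfFin_mem _ _ _
      have hxe : ∀ i, x ∈ Q (e i) := fun i =>
        (hmemF _ (heF i)).2 ▸ (hQ _ (hmemF _ (heF i)).1).2.1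
      refine hM (isMinor_marguerite (G := ⟨V, G⟩) (connected_induce_singleton G x)
        (fun i => Q (e i) \ {x}) ?_ ?_ ?_)
      · exact fun i => (hQ _ (hmemF _ (heF i)).1).1.isPetal (hxe i)
      · intro i j hij
        refine Set.disjoint_left.2 ?_
        rintro y ⟨hy, hyx⟩ ⟨hy', -⟩
        rcases lt_or_gt_of_ne fun h => hij (he h) with h | h
        · exact hyx (((hQ _ (hmemF _ (heF j)).1).2.2 _ h y hy' hy).trans (hmemF _ (heF j)).2)
        · exact hyx (((hQ _ (hmemF _ (heF i)).1).2.2 _ h y hy hy').trans (hmemF _ (heF i)).2)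
      · exact fun i => Set.disjoint_singleton_left.2 fun h => h.2 rfl
    have h1 := Finset.card_le_mul_card_image I k hfib
    exact h1.trans (by rw [sq]; exact Nat.mul_le_mul_left k himage)
  have h1 : m = ((Finset.range m).filter fun i => col i = true).card +
      ((Finset.range m).filter fun i => ¬ col i = true).card := by
    rw [Finset.card_filter_add_card_filter_not, Finset.card_range]
  have h2 := hclass true
  have h3 := hclass false
  simp only [Bool.not_eq_true] at h1
  omega

end Blocks

theorem idf_le_of_not_isMinor {G : FinGraph} {k : ℕ} (hk : 3 ≤ k) (hC : ¬ IsMinor (cycles k) G)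
    (hT : ¬ IsMinor (triangles k) G) (hM : ¬ IsMinor (marguerite k) G) : idf G ≤ 6 * k ^ 4 := by
  rw [idf_le_iff]
  rcases isEmpty_or_nonempty G.V with hV | hV
  · exact (idfOn_zero_of_ncard_le_two (by simp)).mono (Nat.zero_le _)
  obtain ⟨m, Q, a, hm, hQ⟩ := exists_blocks (G := G.graph) (M := 3 * k ^ 2)
    (fun S hS => hS.idfOn hk hC hT hM) Set.univ
  refine hm.mono ?_
  have := card_blocks_le (fun i hi => ⟨(hQ i hi).1, (hQ i hi).2.2⟩) hT hM
  calc m * (3 * k ^ 2) ≤ 2 * k ^ 2 * (3 * k ^ 2) := Nat.mul_le_mul_right _ this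
    _ = 6 * k ^ 4 := by ring

/-! ### The universal obstruction -/

theorem IsParametric.isMinor_add {A : ℕ → FinGraph} (hA : IsParametric A) (k n : ℕ) :
    IsMinor (A k) (A (k + n)) := by
  induction n with
  | zero => exact IsMinor.of_injective id Function.injective_id fun _ _ h => h
  | succ n ih => exact ih.trans (hA _)

theorem isUniversalObstruction_idf :
    IsUniversalObstruction {triangles, cycles, marguerite} idf fun k => 6 * (k + 3) ^ 4 where
  finite := Set.toFinite _
  minorMonotone := minorMonotone_idf
  parametric := by
    rintro A (rfl | rfl | rfl)
    · exact isParametric_triangles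
    · exact isParametric_cycles
    · exact isParametric_marguerite
  noncomparable := pairwise_not_comparable
  upper := by
    intro k G h
    -- The indices below `3` are subsumed, since the graphs of each sequence form a chain.
    have key : ∀ A ∈ ({triangles, cycles, marguerite} : Set (ℕ → FinGraph)), IsParametric A →
        ¬ IsMinor (A (k + 3)) G :=
      fun A hA hpar hmin => h A hA ((hpar.isMinor_add k 3).trans hmin)
    exact idf_le_of_not_isMinor (by omega) (key _ (by simp) isParametric_cycles)
      (key _ (by simp) isParametric_triangles) (key _ (by simp) isParametric_marguerite)
  lower := by
    have key : ∀ k n : ℕ, k ≤ 2 * n + 2 → k ≤ 6 * (n + 3) ^ 4 := by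
      intro k n h
      have : n + 3 ≤ (n + 3) ^ 4 := Nat.le_self_pow (by norm_num) _
      omega
    rintro A (rfl | rfl | rfl) k <;> refine key _ _ ?_
    · have := le_idf_triangles k
      omega
    · rcases Nat.lt_or_ge k 3 with hk | hk
      · omega
      · have := le_idf_cycles hk
        omega
    · rcases Nat.lt_or_ge k 1 with hk | hk
      · omega
      · have := lt_idf_marguerite hk
        omega

theorem isBigO_gap : (fun k : ℕ => ((6 * (k + 3) ^ 4 : ℕ) : ℝ)) =O[Filter.atTop]
    (fun k : ℕ => (k : ℝ) ^ 4 * Real.log (k : ℝ) ^ 2) := by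
  refine Asymptotics.IsBigO.of_bound 96 ?_
  filter_upwards [Filter.eventually_ge_atTop 3] with k hk
  have hk' : (3 : ℝ) ≤ k := by exact_mod_cast hk
  have hlog : 1 ≤ Real.log k := by
    rw [Real.le_log_iff_exp_le (by linarith)]
    linarith [Real.exp_one_lt_d9]
  have h1 : ((k : ℝ) + 3) ^ 4 ≤ (2 * k) ^ 4 := by gcongr; linarith
  have h2 : (k : ℝ) ^ 4 ≤ (k : ℝ) ^ 4 * Real.log k ^ 2 :=
    le_mul_of_one_le_right (by positivity) (one_le_pow₀ hlog)
  rw [Real.norm_of_nonneg (by positivity), Real.norm_of_nonneg (by positivity)]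
  push_cast
  linarith [mul_pow (2 : ℝ) k 4]

end IdForest

theorem theorem3 :
    (∃ f : ℕ → ℕ,
      IdForest.IsUniversalObstruction
        {IdForest.triangles, IdForest.cycles, IdForest.marguerite} IdForest.idf f ∧
      (fun k : ℕ => (f k : ℝ)) =O[Filter.atTop]
        (fun k : ℕ => (k : ℝ) ^ 4 * Real.log (k : ℝ) ^ 2)) ∧
    (∀ k : ℕ, 1 ≤ k →
      IdForest.IsObstruction (IdForest.forestsId k) (IdForest.cycles (2 * k + 1))) ∧
    (∀ k : ℕ,
      IdForest.IsObstruction (IdForest.forestsId k) (IdForest.triangles (k / 2 + 1))) ∧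
    (∀ k : ℕ, 1 ≤ k →
      IdForest.IsObstruction (IdForest.forestsId k) (IdForest.marguerite k)) ∧
    IdForest.IsObstruction (IdForest.forestsId 0) (IdForest.marguerite 1) ∧
    (∀ k : ℕ, IdForest.marguerite (k + 1) ∉ IdForest.forestsId k) := by
  refine ⟨⟨_, IdForest.isUniversalObstruction_idf, IdForest.isBigO_gap⟩,
    fun k hk => IdForest.isObstruction_cycles hk, IdForest.isObstruction_triangles,
    fun k hk => IdForest.isObstruction_marguerite hk le_rfl (Or.inl le_rfl),
    IdForest.isObstruction_marguerite le_rfl (Nat.zero_le 1) (Or.inr le_rfl), fun k h => ?_⟩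
  have h1 : IdForest.idf (IdForest.marguerite (k + 1)) ≤ k := h
  have h2 := IdForest.lt_idf_marguerite (Nat.le_add_left 1 k)
  omega
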